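/- Let $q$ be a prime power and let $k,h$ be integers with $0\le h<k$; put $n=4k+h$. For $i=1,2,3$ let $\mathbf P_i$ be the companion matrix of a primitive polynomial $x^{d}+a_{d-1}x^{d-1}+\dots+a_0$ of degree $d=ik+h$ over $\mathbb F_q$ (ones on the superdiagonal, last row $(-a_0,\dots,-a_{d-1})$), let $$G_i=\{\mathrm{diag}(\mathbf I_{(3-i)k},\mathbf I_k,\mathbf X):\mathbf X\in\langle\mathbf P_i\rangle\}\le \mathrm{GL}_n(\mathbb F_q),$$ and, with $\mathbf I=\mathbf I_{ik+h}$ and writing $\mathbf I^{(j)}$ for the first $j$ rows of $\mathbf I$ and $\mathbf I^{[k]}$ for all rows of $\mathbf I$ after the $k$-th, let $$\mathbf A_i=\begin{bmatrix}\mathbf 0&\mathbf I_k&\mathbf I^{(k)}\\ \mathbf 0&\mathbf 0&\mathbf I^{[k]}\\ \mathbf I_{(3-i)k}&\mathbf 0&\mathbf 0\\ \mathbf 0&\mathbf 0&\mathbf I^{(k-1)}\end{bmatrix},\qquad \mathbf B_i=\begin{bmatrix}\mathbf 0&\mathbf I_k&\mathbf 0\\ \mathbf 0&\mathbf 0&\mathbf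 I^{[k]}\\ \mathbf I_{(3-i)k}&\mathbf 0&\mathbf 0\\ \mathbf 0&\mathbf 0&\mathbf I^{(k-1)}\end{bmatrix}$$ (matrices of size $(n-1)\times n$), and let $\mathbf M$ be the $(n-1)\times n$ matrix with rows $e_n,e_{n-1},\dots,e_2$. For a matrix $\mathbf W$ let $\mathbf W^{(j)}$ consist of its first $j$ rows, and let $\mathrm{rs}$ denote the row space. Let $\mathbf t=(t_1<\dots<t_r)$ be integers with $$k\in\{t_1,\dots,t_r\}\subseteq\{1,\dots,k+h,\;2k+h,\;3k+h,\dots,n-1\},$$ and, if $h=0$, assume that $2k\notin\{t_1,\dots,t_r\}$. Put $$\mathcal C_{\mathbf t}=\bigl\{(\mathrm{rs}(\mathbf W^{(t_1)}),\dots,\mathrm{rs}(\mathbf W^{(t_r)})):\ \mathbf W\in\{\mathbf A_ig,\ \mathbf B_i,\ \mathbf M:\ g\in G_i,\ 1\le i\le 3\}\bigr\}.$$ A flag code of type $\mathbf t$ on $\mathbb F_q^n$ is a non-empty set $\mathcal C$ of flags $\{0\}\subsetneq F_1\subsetneq\dots\subsetneq F_r\subsetneq\mathbb F_q^n$ with $\dim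 F_i=t_i$. Its projected code of dimension $t_i$ is the set of all $i$-th components $F_i$ of its flags, and $\mathcal C$ is cardinality-consistent if each of its projected codes has $|\mathcal C|$ elements. A partial $k$-spread is a non-empty set of $k$-dimensional subspaces that pairwise intersect only in $0$. If $k>\frac{q^h-1}{q-1}$, then $\mathcal C_{\mathbf t}$ is a cardinality-consistent flag code of type $\mathbf t$ whose projected code of dimension $k$ is a partial $k$-spread, it has $$|\mathcal C_{\mathbf t}|=\sum_{i=1}^{3}q^{ik+h}+1$$ elements, and this is the largest possible cardinality: every cardinality-consistent flag code of type $\mathbf t$ on $\mathbb F_q^n$ whose projected code of dimension $k$ is a partial $k$-spread has at most $|\mathcal C_{\mathbf t}|$ elements. -/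

import Mathlib

open scoped Polynomial

namespace FlagCodes

/-! ### Subspace codes and flag codes on `F ^ n` -/

section Codes

variable {F : Type*} [Field F] {n r : ℕ}

/-- A flag of type `t = (t₁, …, t_r)` on `F ^ n`: a strictly increasing sequence of nonzero proper
subspaces whose `i`-th member has dimension `tᵢ`. -/
def IsFlag (t : Fin r → ℕ) (U : Fin r → Submodule F (Fin n → F)) : Prop :=
  StrictMono U ∧ ∀ i, ⊥ < U i ∧ U i < ⊤ ∧ Module.finrank F (U i) = t i

/-- A flag code of type `t` on `F ^ n`: a non-empty set of flags of type `t`. -/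
def IsFlagCode (t : Fin r → ℕ) (C : Set (Fin r → Submodule F (Fin n → F))) : Prop :=
  C.Nonempty ∧ ∀ U ∈ C, IsFlag t U

/-- The `i`-projected code: all subspaces that occur as the `i`-th component of a flag in `C`. -/
def projectedCode (C : Set (Fin r → Submodule F (Fin n → F))) (i : Fin r) :
    Set (Submodule F (Fin n → F)) :=
  (fun U => U i) '' C

/-- All projected codes have as many elements as the flag code itself. -/
def CardinalityConsistent (C : Set (Fin r → Submodule F (Fin n → F))) : Prop :=
  ∀ i, (projectedCode C i).ncard = C.ncard

/-- A partial `k`-spread: a non-empty set of `k`-dimensional subspaces, any two distinct members of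
which intersect in a subspace of dimension `0`. -/
def IsPartialSpread (k : ℕ) (S : Set (Submodule F (Fin n → F))) : Prop :=
  S.Nonempty ∧ (∀ U ∈ S, Module.finrank F U = k) ∧
    ∀ U ∈ S, ∀ V ∈ S, U ≠ V → Module.finrank F (U ⊓ V : Submodule F (Fin n → F)) = 0

/-- `rs(W^{(j)})`: the span of the first `j` rows of the matrix `W`. -/
def rowSpaceFirst {m : ℕ} (W : Matrix (Fin m) (Fin n) F) (j : ℕ) : Submodule F (Fin n → F) :=
  Submodule.span F {v | ∃ x : Fin m, (x : ℕ) < j ∧ v = W x}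

end Codes

/-! ### The matrices of the construction

Rows and columns are numbered from `0`. For `1 ≤ i ≤ s - 1` the `n = s k + h` columns fall into
blocks of widths `(s - i - 1) k`, `k` and `i k + h`. -/

section Construction

variable {F : Type*} [Field F]

/-- A primitive polynomial of degree `d` over the finite field `F`: a monic irreducible polynomial
of degree `d` whose roots generate the multiplicative group of the field with `|F| ^ d` elements,
that is, have multiplicative order `|F| ^ d - 1`. -/
def IsPrimitivePoly [Fintype F] (d : ℕ) (f : F[X]) : Prop :=
  f.Monic ∧ Irreducible f ∧ f.natDegree = d ∧
    orderOf (AdjoinRoot.root f) = Fintype.card F ^ d - 1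

/-- The companion matrix of a monic polynomial `f` of degree `d`: ones above the diagonal, and
`(-a₀, …, -a_{d-1})` as its last row. -/
def companion (d : ℕ) (f : F[X]) : Matrix (Fin d) (Fin d) F :=
  Matrix.of fun x y =>
    if (x : ℕ) + 1 = d then -f.coeff y else if (y : ℕ) = x + 1 then 1 else 0

/-- The block diagonal matrix `diag(I_m, X)` of size `n`, where `X` has size `d` and
`n = m + d`. -/
def diagBlock (n m : ℕ) {d : ℕ} (X : Matrix (Fin d) (Fin d) F) : Matrix (Fin n) (Fin n) F :=
  Matrix.of fun x y =>
    if hxy : (m ≤ (x : ℕ) ∧ (x : ℕ) < m + d) ∧ (m ≤ (y : ℕ) ∧ (y : ℕ) < m + d) then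
      X ⟨x - m, by omega⟩ ⟨y - m, by omega⟩
    else if x = y then 1 else 0

/-- The cyclic group `G_i` of all `diag(I_{(s-i-1)k}, I_k, X)` with `X ∈ ⟨P⟩`, where `P` is the
companion matrix of the polynomial `f` of degree `i k + h`. As `P` is invertible of finite order
when `f` is primitive, `⟨P⟩` is the set of powers of `P` with natural exponents. -/
def groupG (s k h i : ℕ) (f : F[X]) : Set (Matrix (Fin (s * k + h)) (Fin (s * k + h)) F) :=
  {g | ∃ X ∈ Submonoid.powers (companion (i * k + h) f),
    g = diagBlock (s * k + h) ((s - i - 1) * k + k) X}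

/-- The matrix `A_i`, with row blocks of heights `k`, `(i k + h) - k`, `(s - i - 1) k`, `k - 1`:
```
[ 0    I_k  (first k rows of I) ]
[ 0    0    (other rows of I)   ]
[ I    0    0                   ]
[ 0    0    (first k-1 rows of I) ]
```
-/
def matA (F : Type*) [Field F] (s k h i : ℕ) :
    Matrix (Fin (s * k + h - 1)) (Fin (s * k + h)) F :=
  Matrix.of fun x y =>
    let a := (s - i - 1) * k
    let d := i * k + h
    if (x : ℕ) < k then (if (y : ℕ) = a + x ∨ (y : ℕ) = a + k + x then 1 else 0)
    else if (x : ℕ) < d then (if (y : ℕ) = a + k + x then 1 else 0)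
    else if (x : ℕ) < d + a then (if d + (y : ℕ) = x then 1 else 0)
    else (if d + a + (y : ℕ) = a + k + x then 1 else 0)

/-- The matrix `B_i`, which is `A_i` with the upper right `k × (i k + h)` block replaced by `0`. -/
def matB (F : Type*) [Field F] (s k h i : ℕ) :
    Matrix (Fin (s * k + h - 1)) (Fin (s * k + h)) F :=
  Matrix.of fun x y =>
    let a := (s - i - 1) * k
    let d := i * k + h
    if (x : ℕ) < k then (if (y : ℕ) = a + x then 1 else 0)
    else if (x : ℕ) < d then (if (y : ℕ) = a + k + x then 1 else 0)
    else if (x : ℕ) < d + a then (if d + (y : ℕ) = x then 1 else 0)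
    else (if d + a + (y : ℕ) = a + k + x then 1 else 0)

/-- The matrix `M`, whose rows are the last `n - 1` unit vectors of `F ^ n` in reverse order. -/
def matM (F : Type*) [Field F] (s k h : ℕ) :
    Matrix (Fin (s * k + h - 1)) (Fin (s * k + h)) F :=
  Matrix.of fun x y => if (x : ℕ) + y + 1 = s * k + h then 1 else 0

/-- The generator matrices `A_i g` (`g ∈ G_i`), `B_i` (`1 ≤ i ≤ s - 1`) and `M` of the subspaces
from which the codes are built. -/
def generatorMatrices (s k h : ℕ) (f : ℕ → F[X]) :
    Set (Matrix (Fin (s * k + h - 1)) (Fin (s * k + h)) F) :=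
  {W | (∃ i ∈ Finset.Icc 1 (s - 1), ∃ g ∈ groupG s k h i (f i), W = matA F s k h i * g) ∨
    (∃ i ∈ Finset.Icc 1 (s - 1), W = matB F s k h i) ∨ W = matM F s k h}

/-- The code `𝒞_t` of all sequences `(rs(W^{(t₁)}), …, rs(W^{(t_r)}))`. -/
def codeT (s k h : ℕ) (f : ℕ → F[X]) {r : ℕ} (t : Fin r → ℕ) :
    Set (Fin r → Submodule F (Fin (s * k + h) → F)) :=
  (fun W => fun i => rowSpaceFirst W (t i)) '' generatorMatrices s k h f

end Construction

end FlagCodes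

/-! The upper bound uses dimension `k` alone: a cardinality-consistent code has as many flags as its
projected partial `k`-spread has members, so `card_partialSpread_le` applies with `m = ∑ q ^ (i k +
h)`. That bound is a count of holes. A partial spread with `m + 2` members would leave `q ^ (k + h)
- 2 q ^ k + 1` holes. In a subspace of codimension `j < k` the number of holes is `1 - q ^ (k - j)`
modulo `(q - 1) q ^ (k - j)`. Passing repeatedly to a hyperplane with at most the fraction `1 / q`
of the holes, and rounding down by this congruence, makes the count negative after `θ = 1 + q + ⋯ +
q ^ (h - 1) < k` steps.

The construction attains `m + 1`. The powers of a companion matrix together with `0` are `q ^ (i k +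
h)` matrices with invertible differences (`companionField_spec`); `X = 0` stands for `B_i`, and `M`
is the one extra matrix. All generators have independent rows, so their nested row spaces are flags.
It remains to see that distinct generators have distinct row spaces in every admissible dimension
`t`.

For `t ≤ k + h < 2 k` this follows from the trivial intersections in dimension `k`
(`generator_inf_eq_bot`). For `t ≥ 3 k + h` it is the dual statement: two row spaces of dimension `n
- k` together span everything (`generator_orthogonal`). The middle dimension `2 k + h` is compared
block by block (`generator_four_rowSpaceFirst_ne`). -/

namespace FlagCodes

/-! ### Holes of partial spreads and the Năstase–Sissokho bound -/

section PartialSpreadBound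

variable {F V : Type*} [Field F] [Fintype F] [AddCommGroup V] [Module F V]

/-- Averaging over the hyperplanes of `V`: some hyperplane contains at most the fraction `1 / q` of
a given set of nonzero vectors. -/
theorem exists_dual_card_filter_le [Finite V] [Nontrivial V] (Z : Finset V) (hZ : ∀ z ∈ Z, z ≠ 0)
    [DecidableEq F] :
    ∃ φ : Module.Dual F V, φ ≠ 0 ∧
      Fintype.card F * (Z.filter fun z => φ z = 0).card ≤ Z.card := by
  classical
  have := Fintype.ofFinite V
  have : FiniteDimensional F V := Module.Finite.of_finite
  have hfd : Finite (Module.Dual F V) := Module.finite_of_finite F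
  have := Fintype.ofFinite (Module.Dual F V)
  set q := Fintype.card F with hq
  set m := Module.finrank F V with hm
  have hm0 : 0 < m := Module.finrank_pos
  have hq1 : 1 < q := Fintype.one_lt_card
  -- The functionals that vanish at `z ≠ 0` form a hyperplane of the dual space.
  have hcount : ∀ z ∈ Z,
      ((Finset.univ.filter fun φ : Module.Dual F V => φ ≠ 0).filter fun φ => φ z = 0).card + 1
        = q ^ (m - 1) := by
    intro z hz
    have hev : Module.Dual.eval F V z ≠ 0 := by
      rw [Ne, Module.eval_apply_eq_zero_iff]
      exact hZ z hz
    have h1 := Module.Dual.finrank_ker_add_one_of_ne_zero hev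
    rw [Subspace.dual_finrank_eq] at h1
    have h2 : Module.finrank F (LinearMap.ker (Module.Dual.eval F V z)) = m - 1 := by omega
    have h3 := Module.card_eq_pow_finrank (K := F) (V := LinearMap.ker (Module.Dual.eval F V z))
    rw [h2, Fintype.card_subtype] at h3
    rw [← h3, Finset.filter_filter]
    have : (Finset.univ.filter fun x => x ∈ LinearMap.ker (Module.Dual.eval F V z))
        = insert 0 (Finset.univ.filter fun φ : Module.Dual F V => φ ≠ 0 ∧ φ z = 0) := by
      ext φ
      by_cases h0 : φ = 0 <;> simp [h0]
    rw [this, Finset.card_insert_of_notMem (by simp)]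
  have hnz : (Finset.univ.filter fun φ : Module.Dual F V => φ ≠ 0).card + 1 = q ^ m := by
    have h3 := Module.card_eq_pow_finrank (K := F) (V := Module.Dual F V)
    rw [Subspace.dual_finrank_eq] at h3
    rw [← h3, ← Finset.card_univ, ← Finset.card_filter_add_card_filter_not (s := Finset.univ)
      (fun φ : Module.Dual F V => φ ≠ 0)]
    congr 1
    symm
    rw [Finset.card_eq_one]
    exact ⟨0, by ext; simp⟩
  have hpm : q ^ m = q * q ^ (m - 1) := by
    rw [← pow_succ']; congr 1; omega
  -- Double counting turns the left side into `q (q ^ (m - 1) - 1) |Z|` and the right side is `(q ^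
  -- m - 1) |Z|`, so some functional satisfies the inequality termwise.
  have hsum : ∑ φ ∈ Finset.univ.filter (fun φ : Module.Dual F V => φ ≠ 0),
      q * (Z.filter fun z => φ z = 0).card
      ≤ ∑ φ ∈ Finset.univ.filter (fun φ : Module.Dual F V => φ ≠ 0), Z.card := by
    rw [← Finset.mul_sum, Finset.sum_const, smul_eq_mul]
    have := Finset.sum_card_bipartiteAbove_eq_sum_card_bipartiteBelow
      (s := Finset.univ.filter (fun φ : Module.Dual F V => φ ≠ 0)) (t := Z)
      (fun φ z => φ z = 0)
    simp only [Finset.bipartiteAbove, Finset.bipartiteBelow] at this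
    rw [this, Finset.sum_congr rfl fun z hz => Nat.eq_sub_of_add_eq (hcount z hz),
      Finset.sum_const, smul_eq_mul, Nat.eq_sub_of_add_eq hnz, hpm]
    have h1 : 1 ≤ q ^ (m - 1) := Nat.one_le_pow _ _ (by omega)
    obtain ⟨p, hp⟩ := Nat.exists_eq_add_of_le h1
    rw [hp, Nat.add_sub_cancel_left]
    have : q * (1 + p) - 1 = q * p + (q - 1) := by
      rw [mul_add, mul_one]; omega
    rw [this]
    nlinarith [Nat.zero_le ((q - 1) * Z.card)]
  have hne : (Finset.univ.filter fun φ : Module.Dual F V => φ ≠ 0).Nonempty := by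
    rw [← Finset.card_pos]
    have : q ^ 1 ≤ q ^ m := Nat.pow_le_pow_right (by omega) hm0
    rw [pow_one] at this
    omega
  obtain ⟨φ, hφ, hle⟩ := Finset.exists_le_of_sum_le hne hsum
  exact ⟨φ, by simpa using hφ, hle⟩

/-- The version of `exists_dual_card_filter_le` for the hyperplanes of a subspace. -/
theorem exists_hyperplane_card_filter_le [Finite V] (Z : Finset V) (hZ : ∀ z ∈ Z, z ≠ 0)
    (W : Submodule F V) (hW : 0 < Module.finrank F W) [DecidablePred (· ∈ W)] :
    ∃ W' : Submodule F V, Module.finrank F W' + 1 = Module.finrank F W ∧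
      ∀ [DecidablePred (· ∈ W')], Fintype.card F * (Z.filter (· ∈ W')).card
        ≤ (Z.filter (· ∈ W)).card := by
  classical
  have : FiniteDimensional F V := Module.Finite.of_finite
  have : Nontrivial W := Module.finrank_pos_iff.mp hW
  obtain ⟨φ, hφ, hle⟩ := exists_dual_card_filter_le (F := F) (Z.subtype (· ∈ W)) (by
    intro z hz h0
    exact hZ z (by simpa using hz) (by simp [h0]))
  refine ⟨(LinearMap.ker φ).map W.subtype, ?_, ?_⟩
  · rw [Submodule.finrank_map_subtype_eq]
    exact Module.Dual.finrank_ker_add_one_of_ne_zero hφ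
  · intro _
    rw [Finset.card_subtype] at hle
    refine le_trans (Nat.mul_le_mul_left _ ?_) hle
    refine le_trans (le_of_eq ?_) (Finset.card_map (Function.Embedding.subtype _)).le
    congr 1
    ext z
    simp only [Finset.mem_filter, Submodule.mem_map, LinearMap.mem_ker, Submodule.coe_subtype,
      Finset.mem_map, Finset.mem_subtype, Function.Embedding.subtype_apply]
    constructor
    · rintro ⟨hz, w, hw, rfl⟩
      exact ⟨w, ⟨hz, hw⟩, rfl⟩
    · rintro ⟨w, ⟨hz, hw⟩, rfl⟩
      exact ⟨hz, w, hw, rfl⟩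

open Classical in
/-- The holes of a family of subspaces: the nonzero vectors that lie in none of its members. -/
noncomputable def holes [Fintype V] (S : Finset (Submodule F V)) : Finset V :=
  Finset.univ.filter fun v => v ≠ 0 ∧ ∀ U ∈ S, v ∉ U

open Classical in
/-- Counting the nonzero vectors of a subspace by the members of a partial spread. -/
theorem card_holes_filter [Fintype V] (S : Finset (Submodule F V))
    (hS : ∀ U ∈ S, ∀ U' ∈ S, U ≠ U' → U ⊓ U' = ⊥) (W : Submodule F V) :
    (((holes S).filter (· ∈ W)).card : ℤ) = (Fintype.card F : ℤ) ^ Module.finrank F W - 1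
      - ∑ U ∈ S, ((Fintype.card F : ℤ) ^ Module.finrank F (U ⊓ W : Submodule F V) - 1) := by
  have hnz : ∀ U : Submodule F V,
      (((Finset.univ.filter fun v : V => v ≠ 0 ∧ v ∈ U).card : ℕ) : ℤ)
        = (Fintype.card F : ℤ) ^ Module.finrank F U - 1 := by
    intro U
    have h3 := Module.card_eq_pow_finrank (K := F) (V := U)
    rw [Fintype.card_subtype] at h3
    have : (Finset.univ.filter fun x => x ∈ U)
        = insert 0 (Finset.univ.filter fun v : V => v ≠ 0 ∧ v ∈ U) := by
      ext v
      by_cases h0 : v = 0 <;> simp [h0]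
    rw [this, Finset.card_insert_of_notMem (by simp)] at h3
    have h4 := congrArg (Nat.cast : ℕ → ℤ) h3
    push_cast at h4
    linarith
  have hunion : (Finset.univ.filter fun v : V => v ≠ 0 ∧ v ∈ W)
      = (holes S).filter (· ∈ W) ∪
        S.biUnion fun U => Finset.univ.filter fun v : V => v ≠ 0 ∧ v ∈ U ⊓ W := by
    ext v
    simp only [holes, Finset.mem_filter, Finset.mem_univ, true_and, Finset.mem_union,
      Finset.mem_biUnion, Submodule.mem_inf]
    by_cases hv : ∃ U ∈ S, v ∈ U
    · obtain ⟨U, hU, hvU⟩ := hv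
      exact ⟨fun h => Or.inr ⟨U, hU, h.1, hvU, h.2⟩, by
        rintro (h | ⟨_, _, h⟩)
        exacts [⟨h.1.1, h.2⟩, ⟨h.1, h.2.2⟩]⟩
    · push Not at hv
      exact ⟨fun h => Or.inl ⟨⟨h.1, hv⟩, h.2⟩, by
        rintro (h | ⟨_, _, h⟩)
        exacts [⟨h.1.1, h.2⟩, ⟨h.1, h.2.2⟩]⟩
  have hdisj : Disjoint ((holes S).filter (· ∈ W))
      (S.biUnion fun U => Finset.univ.filter fun v : V => v ≠ 0 ∧ v ∈ U ⊓ W) := by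
    rw [Finset.disjoint_left]
    intro v hv hv'
    simp only [holes, Finset.mem_filter, Finset.mem_univ, true_and, Finset.mem_biUnion,
      Submodule.mem_inf] at hv hv'
    obtain ⟨U, hU, h⟩ := hv'
    exact hv.1.2 U hU h.2.1
  have hcard := congrArg Finset.card hunion
  rw [Finset.card_union_of_disjoint hdisj, Finset.card_biUnion] at hcard
  · have h4 := congrArg (Nat.cast : ℕ → ℤ) hcard
    push_cast at h4
    rw [hnz, Finset.sum_congr rfl fun U _ => hnz (U ⊓ W)] at h4
    linarith
  · intro U hU U' hU' hne
    rw [Function.onFun, Finset.disjoint_left]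
    intro v hv hv'
    simp only [Finset.mem_filter, Finset.mem_univ, true_and, Submodule.mem_inf] at hv hv'
    have : v ∈ U ⊓ U' := ⟨hv.2.1, hv'.2.1⟩
    rw [hS U hU U' hU' hne] at this
    exact hv.1 (by simpa using this)

/-- **Năstase–Sissokho bound.** If `k > 1 + q + ⋯ + q ^ (h - 1)`, then a partial `k`-spread of a
space of dimension `n` has at most `m + 1` members, where `m (q ^ k - 1) = q ^ n - q ^ (k + h)`. -/
theorem card_partialSpread_le [Finite V] {k h m : ℕ}
    (hk : ∑ i ∈ Finset.range h, Fintype.card F ^ i < k)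
    (hm : m * (Fintype.card F ^ k - 1) + Fintype.card F ^ (k + h)
      = Fintype.card F ^ Module.finrank F V)
    (hdvd : Fintype.card F ^ k ∣ m)
    (S : Finset (Submodule F V)) (hdim : ∀ U ∈ S, Module.finrank F U = k)
    (hS : ∀ U ∈ S, ∀ U' ∈ S, U ≠ U' → U ⊓ U' = ⊥) : S.card ≤ m + 1 := by
  classical
  by_contra hcon
  -- Exactly `m + 2` members are kept, so that the number of holes is known exactly.
  obtain ⟨T, hTS, hT⟩ := Finset.exists_subset_card_eq (show m + 2 ≤ S.card by omega)
  replace hdim : ∀ U ∈ T, Module.finrank F U = k := fun U hU => hdim U (hTS hU)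
  replace hS : ∀ U ∈ T, ∀ U' ∈ T, U ≠ U' → U ⊓ U' = ⊥ :=
    fun U hU U' hU' => hS U (hTS hU) U' (hTS hU')
  have := Fintype.ofFinite V
  have : FiniteDimensional F V := Module.Finite.of_finite
  set n := Module.finrank F V with hn
  have hq2 : (2 : ℤ) ≤ Fintype.card F := by exact_mod_cast Fintype.one_lt_card (α := F)
  have hmz : (m : ℤ) * ((Fintype.card F : ℤ) ^ k - 1) + (Fintype.card F : ℤ) ^ (k + h)
      = (Fintype.card F : ℤ) ^ n := by
    have := congrArg (Nat.cast : ℕ → ℤ) hm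
    rw [Nat.cast_add, Nat.cast_mul, Nat.cast_sub (Nat.one_le_pow _ _ Fintype.card_pos)] at this
    exact_mod_cast this
  have hdvdz : (Fintype.card F : ℤ) ^ k ∣ (m : ℤ) := by exact_mod_cast hdvd
  have hθ : ((Fintype.card F : ℤ) - 1) * ((∑ i ∈ Finset.range h, Fintype.card F ^ i : ℕ) : ℤ)
      = (Fintype.card F : ℤ) ^ h - 1 := by
    push_cast
    exact mul_geom_sum _ _
  generalize hθd : ∑ i ∈ Finset.range h, Fintype.card F ^ i = θ at hk hθ
  have hkn : k ≤ n := by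
    obtain ⟨U, hU⟩ : T.Nonempty := by rw [← Finset.card_pos]; omega
    rw [← hdim U hU]
    exact Submodule.finrank_le U
  set q : ℤ := (Fintype.card F : ℤ) with hq
  have hqpos : ∀ e : ℕ, 0 < q ^ e := fun e => pow_pos (by omega) e
  -- The coprime factors are treated separately. Modulo `q - 1` every power of `q` is `1`. Modulo `q
  -- ^ (k - j)` the powers vanish, because a `k`-dimensional `U` meets `W` in dimension at least `k
  -- - j`, and the constants add up to `m`, which `q ^ k` divides.
  have hmod : ∀ j < k, ∀ W : Submodule F V, Module.finrank F W + j = n →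
      (q - 1) * q ^ (k - j) ∣ (((holes T).filter (· ∈ W)).card : ℤ) + q ^ (k - j) - 1 := by
    intro j hj W hW
    rw [card_holes_filter T hS W]
    refine IsCoprime.mul_dvd (IsCoprime.pow_right ⟨-1, 1, by ring⟩) ?_ ?_
    · have h1 : ∀ e : ℕ, q - 1 ∣ q ^ e - 1 := fun e => by simpa using sub_dvd_pow_sub_pow q 1 e
      have : ∀ x y z : ℤ, x - 1 - y + z - 1 = (x - 1) - y + (z - 1) := fun _ _ _ => by ring
      rw [this]
      exact dvd_add (dvd_sub (h1 _) (Finset.dvd_sum fun U _ => h1 _)) (h1 _)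
    · rw [Finset.sum_sub_distrib, Finset.sum_const, hT]
      have e1 : q ^ (k - j) ∣ q ^ Module.finrank F W := pow_dvd_pow _ (by omega)
      have e2 : q ^ (k - j) ∣ ∑ U ∈ T, q ^ Module.finrank F (U ⊓ W : Submodule F V) := by
        refine Finset.dvd_sum fun U hU => pow_dvd_pow _ ?_
        have h1 := Submodule.finrank_sup_add_finrank_inf_eq U W
        have h2 := Submodule.finrank_le (U ⊔ W)
        rw [hdim U hU] at h1
        omega
      have e3 : q ^ (k - j) ∣ (m : ℤ) := (pow_dvd_pow _ (by omega)).trans hdvdz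
      have : ∀ x y z : ℤ, x - 1 - (y - (m + 2) • (1 : ℤ)) + z - 1 = x - y + m + z :=
        fun _ _ _ => by simp; ring
      rw [this]
      exact dvd_add (dvd_add (dvd_sub e1 e2) e3) dvd_rfl
  -- For `j = 0` and `W = ⊤` this is an equality, since `(q - 1) θ = q ^ h - 1`. Each hyperplane
  -- lowers the coefficient `θ - j` by one.
  have hdesc : ∀ j ≤ θ, ∃ W : Submodule F V, Module.finrank F W + j = n ∧
      (((holes T).filter (· ∈ W)).card : ℤ)
        ≤ (q - 1) * (θ - j) * q ^ (k - j) - q ^ (k - j) + 1 := by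
    intro j
    induction j with
    | zero =>
      intro _
      refine ⟨⊤, by simp [hn], ?_⟩
      rw [card_holes_filter T hS ⊤]
      have hsum : ∑ U ∈ T, (q ^ Module.finrank F (U ⊓ ⊤ : Submodule F V) - 1)
          = ∑ U ∈ T, (q ^ k - 1) :=
        Finset.sum_congr rfl fun U hU => by rw [inf_top_eq, hdim U hU]
      simp only [finrank_top, Nat.sub_zero, Nat.cast_zero, sub_zero]
      rw [← hq, hsum, Finset.sum_const, hT, ← hn, hθ,
        ← hmz, pow_add]
      simp only [nsmul_eq_mul]
      push_cast
      linarith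
    | succ j ih =>
      intro hj
      obtain ⟨W, hW, hle⟩ := ih (by omega)
      obtain ⟨W', hW', hle'⟩ := exists_hyperplane_card_filter_le (F := F) (holes T)
        (by intro z hz; simp only [holes, Finset.mem_filter] at hz; exact hz.2.1) W (by omega)
      refine ⟨W', by omega, ?_⟩
      replace hle' := @hle' inferInstance
      replace hle' : q * (((holes T).filter (· ∈ W')).card : ℤ)
          ≤ (((holes T).filter (· ∈ W)).card : ℤ) := by rw [hq]; exact_mod_cast hle'
      obtain ⟨c, hc⟩ := hmod (j + 1) (by omega) W' (by omega)
      have hpow : q ^ (k - j) = q * q ^ (k - (j + 1)) := by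
        rw [← pow_succ']; congr 1; omega
      rw [hpow] at hle
      generalize (((holes T).filter (· ∈ W')).card : ℤ) = z' at *
      generalize (((holes T).filter (· ∈ W)).card : ℤ) = z at *
      have hQ := hqpos (k - (j + 1))
      generalize q ^ (k - (j + 1)) = Q at *
      have hz' : z' = (q - 1) * Q * c - Q + 1 := by linarith
      rw [hz'] at hle' ⊢
      -- Multiplying `z'` by `q` turns its constant `1` into `q`, against the `1` in the bound for
      -- `z`; this makes the inequality strict, and integrality of `c` gains a full unit.
      have h1 : ((q - 1) * (q * Q)) * c < ((q - 1) * (q * Q)) * (θ - j) := by nlinarith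
      have h2 : c < θ - j := lt_of_mul_lt_mul_left h1
        (mul_nonneg (by omega) (mul_nonneg (by omega) hQ.le))
      have h3 : c ≤ θ - (j + 1) := by omega
      have h4 := mul_le_mul_of_nonneg_left h3
        (show 0 ≤ (q - 1) * Q from mul_nonneg (by omega) hQ.le)
      push_cast
      linarith
  obtain ⟨W, -, hle⟩ := hdesc θ le_rfl
  -- At `j = θ` the bound reads `1 - q ^ (k - θ)`, negative because `θ < k`.
  have h1 : q ^ 1 ≤ q ^ (k - θ) := pow_le_pow_right₀ (by omega) (by omega)
  simp only [sub_self, mul_zero, zero_mul, zero_sub] at hle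
  have h2 : (0 : ℤ) ≤ (((holes T).filter (· ∈ W)).card : ℤ) := Int.natCast_nonneg _
  linarith

end PartialSpreadBound

/-! ### Companion matrices and the field they generate -/

section Companion

variable {F : Type*} [Field F]

theorem companion_row_of_lt {d : ℕ} (f : F[X]) {j : ℕ} (hj : j + 1 < d) :
    (companion d f).row ⟨j, by omega⟩ = Pi.single ⟨j + 1, hj⟩ 1 := by
  ext y
  simp only [Matrix.row, companion, Matrix.of_apply, Pi.single_apply, Fin.ext_iff]
  rw [if_neg (by omega)]

theorem single_vecMul_companion_pow {d : ℕ} (f : F[X]) {j : ℕ} (hj : j < d) :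
    Matrix.vecMul (Pi.single ⟨0, by omega⟩ 1) (companion d f ^ j) = Pi.single ⟨j, hj⟩ 1 := by
  induction j with
  | zero => simp
  | succ j ih =>
    rw [pow_succ, ← Matrix.vecMul_vecMul, ih (by omega), Matrix.single_one_vecMul,
      companion_row_of_lt]

/-- A monic polynomial annihilates its companion matrix. -/
theorem aeval_companion {d : ℕ} {f : F[X]} (hf : f.Monic) (hd : f.natDegree = d) :
    Polynomial.aeval (companion d f) f = 0 := by
  rcases Nat.eq_zero_or_pos d with rfl | hpos
  · exact Subsingleton.elim _ _
  -- The first unit vector is cyclic for the companion matrix `P`, and `f(P)` commutes with `P`;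
  -- hence `f(P) = 0` once `f(P)` kills that vector.
  have h0 : Matrix.vecMul (Pi.single ⟨0, hpos⟩ 1) (Polynomial.aeval (companion d f) f) = 0 := by
    rw [Polynomial.aeval_eq_sum_range, Matrix.vecMul_sum, hd, Finset.sum_range_succ,
      ← Fin.sum_univ_eq_sum_range (fun j => Matrix.vecMul (Pi.single (⟨0, hpos⟩ : Fin d) (1 : F))
        (f.coeff j • companion d f ^ j)) d]
    obtain ⟨e, rfl⟩ : ∃ e, d = e + 1 := ⟨d - 1, by omega⟩
    rw [pow_succ, Matrix.vecMul_smul, ← Matrix.vecMul_vecMul,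
      single_vecMul_companion_pow f (by omega), Matrix.single_one_vecMul]
    have hlead : f.coeff (e + 1) = 1 := by rw [← hd]; exact hf
    have hsum : ∀ j : Fin (e + 1), Matrix.vecMul (Pi.single (⟨0, hpos⟩ : Fin (e + 1)) (1 : F))
        (f.coeff j • companion (e + 1) f ^ (j : ℕ)) = Pi.single j (f.coeff j) := fun j => by
      rw [Matrix.vecMul_smul, single_vecMul_companion_pow f j.isLt]
      ext y
      simp [Pi.single_apply]
    rw [Finset.sum_congr rfl fun j _ => hsum j, hlead, one_smul]
    ext y
    simp [Finset.sum_apply, Pi.single_apply, Matrix.row, companion]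
  refine Matrix.ext_of_single_vecMul fun j => ?_
  rw [← single_vecMul_companion_pow f j.isLt, Matrix.vecMul_vecMul]
  have hcomm : companion d f ^ (j : ℕ) * Polynomial.aeval (companion d f) f
      = Polynomial.aeval (companion d f) f * companion d f ^ (j : ℕ) := by
    have := Polynomial.aeval_X_pow (R := F) (companion d f) (n := (j : ℕ))
    rw [← this, ← map_mul, ← map_mul, mul_comm]
  rw [hcomm, ← Matrix.vecMul_vecMul, h0, Matrix.zero_vecMul, Matrix.vecMul_zero]

/-- The matrices `0` and `P ^ j`, where `P` is the companion matrix of `f`. When `f` is primitive,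
they form the field with `q ^ d` elements. -/
def companionField (d : ℕ) (f : F[X]) : Set (Matrix (Fin d) (Fin d) F) :=
  insert 0 (Submonoid.powers (companion d f) : Set (Matrix (Fin d) (Fin d) F))

variable [Fintype F] {d : ℕ} {f : F[X]}

/-- Evaluation at the companion matrix embeds the field `F[X] / (f)` into the matrices, so nonzero
elements, in particular differences of distinct ones, become units. The count is the order of the
root plus one for `0`. -/
theorem companionField_spec (hf : IsPrimitivePoly d f) (hd : 0 < d) :
    (companionField d f).ncard = Fintype.card F ^ d ∧
      (∀ X ∈ Submonoid.powers (companion d f), IsUnit X) ∧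
      ∀ X ∈ companionField d f, ∀ Y ∈ companionField d f, X ≠ Y → IsUnit (X - Y) := by
  obtain ⟨hm, hirr, hdeg, hord⟩ := hf
  have : Fact (Irreducible f) := ⟨hirr⟩
  have : Nonempty (Fin d) := ⟨⟨0, hd⟩⟩
  let Φ : AdjoinRoot f →ₐ[F] Matrix (Fin d) (Fin d) F :=
    Ideal.Quotient.liftₐ (Ideal.span {f}) (Polynomial.aeval (companion d f)) (by
      intro a ha
      obtain ⟨b, rfl⟩ := Ideal.mem_span_singleton.mp ha
      rw [map_mul, aeval_companion hm hdeg, zero_mul])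
  have hΦ : Φ (AdjoinRoot.root f) = companion d f := Polynomial.aeval_X _
  have hinj : Function.Injective Φ := Φ.toRingHom.injective
  have hcard : 1 < Fintype.card F ^ d := Nat.one_lt_pow hd.ne' Fintype.one_lt_card
  have hroot : AdjoinRoot.root f ≠ 0 := by
    intro h0
    have h1 := pow_orderOf_eq_one (AdjoinRoot.root f)
    rw [h0, zero_pow] at h1
    · exact zero_ne_one h1
    · rw [← h0, hord]; omega
  have himage : companionField d f
      = Φ '' (insert 0 (Submonoid.powers (AdjoinRoot.root f) : Set (AdjoinRoot f))) := by
    rw [Set.image_insert_eq, map_zero, companionField, ← hΦ]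
    congr 1
    ext X
    simp only [SetLike.mem_coe, Submonoid.mem_powers_iff, Set.mem_image,
      exists_exists_eq_and, map_pow]
  refine ⟨?_, ?_, ?_⟩
  · rw [himage, Set.ncard_image_of_injective _ hinj]
    -- The powers are counted in the unit group, where cancellation makes their number the order of
    -- the root.
    have hpow : (Submonoid.powers (AdjoinRoot.root f) : Set (AdjoinRoot f))
        = Units.val '' (Submonoid.powers (Units.mk0 _ hroot) : Set (AdjoinRoot f)ˣ) := by
      ext X
      simp only [SetLike.mem_coe, Submonoid.mem_powers_iff, Set.mem_image,
        exists_exists_eq_and, Units.val_pow_eq_pow_val, Units.val_mk0]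
    have hn : (Submonoid.powers (AdjoinRoot.root f) : Set (AdjoinRoot f)).ncard
        = Fintype.card F ^ d - 1 := by
      rw [hpow, Set.ncard_image_of_injective _ Units.val_injective, ← hord,
        ← Nat.card_coe_set_eq]
      exact Nat.card_submonoidPowers.trans (orderOf_units.symm.trans (by rw [Units.val_mk0]))
    rw [Set.ncard_insert_of_notMem _ (Set.finite_of_ncard_pos (by omega)), hn]
    · omega
    · simp only [SetLike.mem_coe, Submonoid.mem_powers_iff, not_exists]
      exact fun j => pow_ne_zero j hroot
  · rintro X ⟨j, rfl⟩
    simp only [← hΦ, ← map_pow]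
    exact IsUnit.map Φ (isUnit_iff_ne_zero.mpr (pow_ne_zero j hroot))
  · intro X hX Y hY hXY
    rw [himage] at hX hY
    obtain ⟨x, -, rfl⟩ := hX
    obtain ⟨y, -, rfl⟩ := hY
    rw [← map_sub]
    refine IsUnit.map Φ (isUnit_iff_ne_zero.mpr (sub_ne_zero.mpr ?_))
    rintro rfl
    exact hXY rfl

end Companion

/-! ### Row spaces and orthogonal vectors of a single block shape -/

section Blocks

variable {F : Type*} [Field F]

/-- The matrix whose first `k` rows are those of `X` and whose other rows are those of `Y`. -/
def mixRows (k : ℕ) {d : ℕ} (X Y : Matrix (Fin d) (Fin d) F) : Matrix (Fin d) (Fin d) F :=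
  Matrix.of fun i j => if (i : ℕ) < k then X i j else Y i j

/-- `W` is an `(n - 1) × n` matrix of the form
```
[ 0    I_k  (first k rows of X)     ]
[ 0    0    (other rows of Y)       ]
[ I_a  0    0                       ]
[ 0    0    (first k - 1 rows of Y) ]
```
-/
structure IsBlock (k a : ℕ) {n d : ℕ} (X Y : Matrix (Fin d) (Fin d) F)
    (W : Matrix (Fin (n - 1)) (Fin n) F) : Prop where
  sum_eq : a + k + d = n
  pos : 0 < k
  le : k ≤ d
  left : ∀ (x : Fin (n - 1)) (y : Fin n), (x : ℕ) < d → (y : ℕ) < a + k →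
    W x y = if (y : ℕ) = a + x then 1 else 0
  right : ∀ (x : Fin (n - 1)) (y : Fin n) (i j : Fin d), (x : ℕ) = i → (y : ℕ) = a + k + j →
    W x y = mixRows k X Y i j
  lower : ∀ (x : Fin (n - 1)) (y : Fin n), d ≤ (x : ℕ) → (x : ℕ) < d + a →
    W x y = if d + (y : ℕ) = x then 1 else 0
  bottom_left : ∀ (x : Fin (n - 1)) (y : Fin n), d + a ≤ (x : ℕ) → (y : ℕ) < a + k → W x y = 0
  bottom_right : ∀ (x : Fin (n - 1)) (y : Fin n) (i j : Fin d), (x : ℕ) = d + a + i →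
    (y : ℕ) = a + k + j → W x y = Y i j

/-- The pairs of matrices that occur in the blocks of the construction. -/
def IsBlockPair {d : ℕ} (X Y : Matrix (Fin d) (Fin d) F) : Prop :=
  (IsUnit X ∧ Y = X) ∨ (X = 0 ∧ Y = 1)

theorem IsBlockPair.isUnit_right {d : ℕ} {X Y : Matrix (Fin d) (Fin d) F}
    (h : IsBlockPair X Y) : IsUnit Y := by
  rcases h with ⟨h, rfl⟩ | ⟨-, rfl⟩
  exacts [h, isUnit_one]

theorem sum_fin_split {M : Type*} [AddCommMonoid M] {n a k d : ℕ} (h : a + k + d = n)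
    (u : Fin n → M) :
    ∑ y, u y = ∑ x : Fin a, u ⟨x, by omega⟩ + ∑ x : Fin k, u ⟨a + x, by omega⟩
      + ∑ x : Fin d, u ⟨a + k + x, by omega⟩ := by
  subst h
  rw [Fin.sum_univ_add, Fin.sum_univ_add]
  rfl

theorem mixRows_self {R : Type*} (k : ℕ) {d : ℕ} (X : Matrix (Fin d) (Fin d) R) : mixRows k X X = X := by
  ext i j
  simp [mixRows]

theorem vecMul_mixRows_of_support {k d : ℕ} {X Y : Matrix (Fin d) (Fin d) F} {c : Fin d → F}
    (hc : ∀ x : Fin d, k ≤ (x : ℕ) → c x = 0) :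
    Matrix.vecMul c (mixRows k X Y) = Matrix.vecMul c X := by
  ext j
  simp only [Matrix.vecMul, dotProduct, mixRows, Matrix.of_apply]
  refine Finset.sum_congr rfl fun x _ => ?_
  split_ifs with hx
  · rfl
  · rw [hc x (by omega), zero_mul, zero_mul]

theorem row_mem_rowSpaceFirst {m n t : ℕ} (W : Matrix (Fin m) (Fin n) F) {x : Fin m}
    (hx : (x : ℕ) < t) : W x ∈ rowSpaceFirst W t :=
  Submodule.subset_span ⟨x, hx, rfl⟩

theorem rowSpaceFirst_mono {m n t t' : ℕ} (W : Matrix (Fin m) (Fin n) F) (h : t ≤ t') :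
    rowSpaceFirst W t ≤ rowSpaceFirst W t' :=
  Submodule.span_mono fun _ ⟨x, hx, hv⟩ => ⟨x, hx.trans_le h, hv⟩

theorem finrank_rowSpaceFirst {m n t : ℕ} {W : Matrix (Fin m) (Fin n) F}
    (hW : LinearIndependent F W) (ht : t ≤ m) : Module.finrank F (rowSpaceFirst W t) = t := by
  have : rowSpaceFirst W t
      = Submodule.span F (Set.range fun x : Fin t => W ⟨x, by omega⟩) := by
    rw [rowSpaceFirst]
    congr 1
    ext v
    constructor
    · rintro ⟨x, hx, rfl⟩
      exact ⟨⟨x, hx⟩, rfl⟩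
    · rintro ⟨x, rfl⟩
      exact ⟨_, x.isLt, rfl⟩
  rw [this, finrank_span_eq_card, Fintype.card_fin]
  exact hW.comp (fun x : Fin t => (⟨x, by omega⟩ : Fin m)) fun x y h => by
    simpa [Fin.ext_iff] using h

/-- A proper subspace of `F ^ n` is orthogonal to some nonzero vector. -/
theorem exists_dotProduct_eq_zero {n : ℕ} {T : Submodule F (Fin n → F)} (hT : T ≠ ⊤) :
    ∃ y : Fin n → F, y ≠ 0 ∧ ∀ v ∈ T, v ⬝ᵥ y = 0 := by
  obtain ⟨φ, hφ, hle⟩ := Submodule.exists_le_ker_of_lt_top T hT.lt_top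
  have hdot : ∀ v, v ⬝ᵥ (fun i => φ (Pi.single i 1)) = φ v := fun v => by
    rw [LinearMap.pi_apply_eq_sum_univ φ v]
    refine Finset.sum_congr rfl fun i _ => ?_
    refine congrArg (fun w => v i * φ w) (funext fun j => ?_)
    simp only [Pi.single_apply, eq_comm]
  refine ⟨fun i => φ (Pi.single i 1), ?_, fun v hv => (hdot v).trans (hle hv)⟩
  intro h0
  refine hφ (LinearMap.ext fun v => ?_)
  rw [← hdot v, h0, dotProduct_zero, LinearMap.zero_apply]

namespace IsBlock

variable {k a n d : ℕ} {X Y : Matrix (Fin d) (Fin d) F} {W : Matrix (Fin (n - 1)) (Fin n) F}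

/-- Coordinates of the vectors in the span of the first `t` rows. -/
theorem exists_coeff (hW : IsBlock k a X Y W) {t : ℕ} (ht : t ≤ d + a) {v : Fin n → F}
    (hv : v ∈ rowSpaceFirst W t) :
    ∃ c : Fin d → F, (∀ x : Fin d, t ≤ (x : ℕ) → c x = 0) ∧
      (∀ (x : Fin d) (y : Fin n), (x : ℕ) < k → (y : ℕ) = a + x → v y = c x) ∧
      (∀ (j : Fin d) (y : Fin n), (y : ℕ) = a + k + j →
        v y = Matrix.vecMul c (mixRows k X Y) j) ∧
      (t ≤ d → ∀ y : Fin n, (y : ℕ) < a → v y = 0) := by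
  induction hv using Submodule.span_induction with
  | mem v hv =>
    obtain ⟨x, hx, rfl⟩ := hv
    by_cases hxd : (x : ℕ) < d
    · refine ⟨Pi.single ⟨x, hxd⟩ 1, ?_, ?_, ?_, ?_⟩
      · intro z hz
        rw [Pi.single_apply, if_neg (by simp only [Fin.ext_iff]; omega)]
      · intro z y hz hy
        rw [hW.left x y hxd (by omega), Pi.single_apply]
        simp only [Fin.ext_iff]
        exact if_congr (by omega) rfl rfl
      · intro j y hy
        rw [hW.right x y ⟨x, hxd⟩ j rfl hy, Matrix.single_one_vecMul]
        rfl
      · intro _ y hy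
        rw [hW.left x y hxd (by omega), if_neg (by omega)]
    · have hxa : (x : ℕ) < d + a := by omega
      refine ⟨0, fun _ _ => rfl, ?_, ?_, ?_⟩
      · intro z y hz hy
        rw [hW.lower x y (by omega) hxa, if_neg (by omega), Pi.zero_apply]
      · intro j y hy
        rw [hW.lower x y (by omega) hxa, if_neg (by omega), Matrix.zero_vecMul, Pi.zero_apply]
      · intro htd
        omega
  | zero => exact ⟨0, fun _ _ => rfl, fun _ _ _ _ => rfl, by simp, fun _ _ _ => rfl⟩
  | add v w _ _ hv hw =>
    obtain ⟨c, h1, h2, h3, h4⟩ := hv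
    obtain ⟨c', h1', h2', h3', h4'⟩ := hw
    refine ⟨c + c', ?_, ?_, ?_, ?_⟩
    · intro x hx
      rw [Pi.add_apply, h1 x hx, h1' x hx, add_zero]
    · intro x y hx hy
      rw [Pi.add_apply, Pi.add_apply, h2 x y hx hy, h2' x y hx hy]
    · intro j y hy
      rw [Pi.add_apply, h3 j y hy, h3' j y hy, Matrix.add_vecMul, Pi.add_apply]
    · intro ht y hy
      rw [Pi.add_apply, h4 ht y hy, h4' ht y hy, add_zero]
  | smul r v _ hv =>
    obtain ⟨c, h1, h2, h3, h4⟩ := hv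
    refine ⟨r • c, ?_, ?_, ?_, ?_⟩
    · intro x hx
      rw [Pi.smul_apply, h1 x hx, smul_zero]
    · intro x y hx hy
      rw [Pi.smul_apply, Pi.smul_apply, h2 x y hx hy]
    · intro j y hy
      rw [Pi.smul_apply, h3 j y hy, Matrix.smul_vecMul, Pi.smul_apply]
    · intro ht y hy
      rw [Pi.smul_apply, h4 ht y hy, smul_zero]

/-- The last `d` coordinates of a vector of length `n`. -/
def tail (d : ℕ) {n : ℕ} (y : Fin n → F) : Fin d → F :=
  fun j => if h : n - d + j < n then y ⟨n - d + j, h⟩ else 0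

theorem tail_apply (hW : IsBlock k a X Y W) (v : Fin n → F) (j : Fin d) :
    tail d v j = v ⟨a + k + j, by have := hW.sum_eq; omega⟩ := by
  have := hW.sum_eq
  rw [tail, dif_pos (by omega)]
  congr 2
  omega

theorem row_dotProduct_of_lt (hW : IsBlock k a X Y W) (v : Fin n → F) (x : Fin (n - 1))
    (i : Fin d) (hx : (x : ℕ) = i) (y : Fin n) (hik : (i : ℕ) < k) (hy : (y : ℕ) = a + i) :
    W x ⬝ᵥ v = v y + Matrix.mulVec X (tail d v) i := by
  have hs := hW.sum_eq
  rw [dotProduct, sum_fin_split hs]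
  have e1 : ∑ z : Fin a, W x ⟨z, by omega⟩ * v ⟨z, by omega⟩ = 0 :=
    Finset.sum_eq_zero fun z _ => by
      rw [hW.left _ _ (by omega) (by simp only; omega), if_neg (by simp only; omega), zero_mul]
  have e2 : ∑ z : Fin k, W x ⟨a + z, by omega⟩ * v ⟨a + z, by omega⟩ = v y := by
    rw [Finset.sum_eq_single ⟨i, hik⟩]
    · rw [hW.left _ _ (by omega) (by simp only; omega), if_pos (by simp only; omega), one_mul]
      congr 1
      ext
      simp [hy]
    · intro z _ hz
      rw [hW.left _ _ (by omega) (by simp only; omega), if_neg, zero_mul]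
      intro h
      apply hz
      ext
      simp only at h ⊢
      omega
    · simp
  have e3 : ∑ z : Fin d, W x ⟨a + k + z, by omega⟩ * v ⟨a + k + z, by omega⟩
      = Matrix.mulVec X (tail d v) i :=
    Finset.sum_congr rfl fun z _ => by
      rw [hW.right x _ i z hx rfl, hW.tail_apply, mixRows, Matrix.of_apply, if_pos hik]
  rw [e1, e2, e3, zero_add]

theorem row_dotProduct_of_le (hW : IsBlock k a X Y W) (v : Fin n → F) (x : Fin (n - 1))
    (i : Fin d) (hx : ((x : ℕ) = i ∧ k ≤ (i : ℕ)) ∨ (x : ℕ) = d + a + i) :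
    W x ⬝ᵥ v = Matrix.mulVec Y (tail d v) i := by
  have hs := hW.sum_eq
  have hz : ∀ z : Fin n, (z : ℕ) < a + k → W x z = 0 := by
    intro z hz
    rcases hx with ⟨hx, hik⟩ | hx
    · rw [hW.left _ _ (by omega) hz, if_neg (by omega)]
    · exact hW.bottom_left _ _ (by omega) hz
  rw [dotProduct, sum_fin_split hs]
  have e1 : ∑ z : Fin a, W x ⟨z, by omega⟩ * v ⟨z, by omega⟩ = 0 :=
    Finset.sum_eq_zero fun z _ => by rw [hz _ (by simp only; omega), zero_mul]
  have e2 : ∑ z : Fin k, W x ⟨a + z, by omega⟩ * v ⟨a + z, by omega⟩ = 0 :=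
    Finset.sum_eq_zero fun z _ => by rw [hz _ (by simp only; omega), zero_mul]
  have e3 : ∑ z : Fin d, W x ⟨a + k + z, by omega⟩ * v ⟨a + k + z, by omega⟩
      = Matrix.mulVec Y (tail d v) i :=
    Finset.sum_congr rfl fun z _ => by
      rw [hW.tail_apply]
      rcases hx with ⟨hx, hik⟩ | hx
      · rw [hW.right x _ i z hx rfl, mixRows, Matrix.of_apply, if_neg (by omega)]
      · rw [hW.bottom_right x _ i z hx rfl]
  rw [e1, e2, e3, zero_add, zero_add]

theorem row_dotProduct_lower (hW : IsBlock k a X Y W) (v : Fin n → F) (x : Fin (n - 1))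
    (y : Fin n) (hya : (y : ℕ) < a) (hx : (x : ℕ) = d + y) : W x ⬝ᵥ v = v y := by
  rw [dotProduct, Finset.sum_eq_single y]
  · rw [hW.lower x y (by omega) (by omega), if_pos hx.symm, one_mul]
  · intro z _ hz
    rw [hW.lower x z (by omega) (by omega), if_neg, zero_mul]
    intro h
    exact hz (Fin.ext (by omega))
  · simp

/-- The rows are linearly independent. -/
theorem linearIndependent (hW : IsBlock k a X Y W) (hY : IsUnit Y) : LinearIndependent F W := by
  have hs := hW.sum_eq
  have hle := hW.le
  refine (Matrix.vecMul_injective_iff (M := W)).mp ?_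
  -- Surjectivity of `v ↦ W v` gives independence of the rows. The system is solved from the tail
  -- upwards: `Y` is inverted first, then the middle block is read off the first `k` rows, and the
  -- first block off the unit rows.
  have hsurj : ∀ b : Fin (n - 1) → F, ∃ v, Matrix.mulVec W v = b := by
    intro b
    -- The bottom block has only `k - 1` rows, so coordinate `k - 1` of `Y w` is unconstrained and
    -- set to `0`.
    let s : Fin d → F := fun i =>
      if k ≤ (i : ℕ) then (if h : (i : ℕ) < n - 1 then b ⟨i, h⟩ else 0)
      else if h : d + a + i < n - 1 then b ⟨d + a + i, h⟩ else 0
    obtain ⟨w, hw⟩ := Matrix.mulVec_surjective_iff_isUnit.mpr hY s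
    let v : Fin n → F := fun y =>
      if h : (y : ℕ) < a then b ⟨d + y, by have := hW.pos; omega⟩
      else if h' : (y : ℕ) < a + k then
        b ⟨y - a, by omega⟩ - Matrix.mulVec X w ⟨y - a, by omega⟩
      else w ⟨y - (a + k), by omega⟩
    have htail : tail d v = w := by
      ext j
      rw [hW.tail_apply]
      simp only [v]
      rw [dif_neg (by omega), dif_neg (by omega)]
      congr 1
      ext
      simp
    refine ⟨v, ?_⟩
    ext x
    rw [Matrix.mulVec]
    by_cases h1 : (x : ℕ) < k
    · rw [hW.row_dotProduct_of_lt v x ⟨x, by omega⟩ rfl ⟨a + x, by omega⟩ h1 rfl, htail]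
      simp only [v]
      rw [dif_neg (by omega), dif_pos (by omega)]
      simp only [Nat.add_sub_cancel_left, sub_add_cancel, Fin.eta]
    · by_cases h2 : (x : ℕ) < d
      · rw [hW.row_dotProduct_of_le v x ⟨x, h2⟩ (Or.inl ⟨rfl, by simp only; omega⟩), htail, hw]
        simp only [s]
        rw [if_pos (by omega), dif_pos (by omega)]
      · by_cases h3 : (x : ℕ) < d + a
        · rw [hW.row_dotProduct_lower v x ⟨x - d, by omega⟩ (by simp only; omega)
            (by simp only; omega)]
          simp only [v]
          rw [dif_pos (by omega)]
          congr 1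
          ext
          simp only
          omega
        · rw [hW.row_dotProduct_of_le v x ⟨x - (d + a), by omega⟩
            (Or.inr (by simp only; omega)), htail, hw]
          simp only [s]
          rw [if_neg (by omega), dif_pos (by omega)]
          congr 1
          ext
          simp only
          omega
  intro c c' hcc
  rw [← sub_eq_zero]
  refine dotProduct_eq_zero _ fun b => ?_
  obtain ⟨v, rfl⟩ := hsurj b
  have hcc' : Matrix.vecMul c W = Matrix.vecMul c' W := hcc
  rw [Matrix.dotProduct_mulVec, Matrix.sub_vecMul, hcc', sub_self, zero_dotProduct]

/-- A vector in the span of the first `k` rows vanishes if its coordinates in the second block do. -/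
theorem eq_zero_of_mem (hW : IsBlock k a X Y W) {v : Fin n → F} (hv : v ∈ rowSpaceFirst W k)
    (h0 : ∀ y : Fin n, a ≤ (y : ℕ) → (y : ℕ) < a + k → v y = 0) : v = 0 := by
  have hs := hW.sum_eq
  have hle := hW.le
  obtain ⟨c, h1, h2, h3, h4⟩ := hW.exists_coeff (by omega) hv
  have hc : c = 0 := by
    ext x
    by_cases hx : (x : ℕ) < k
    · rw [← h2 x ⟨a + x, by omega⟩ hx rfl]
      exact h0 _ (by simp only; omega) (by simp only; omega)
    · exact h1 x (by omega)
  ext y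
  by_cases hya : (y : ℕ) < a
  · exact h4 hle y hya
  · by_cases hyk : (y : ℕ) < a + k
    · exact h0 y (by omega) hyk
    · rw [h3 ⟨y - (a + k), by omega⟩ y (by simp only; omega), hc, Matrix.zero_vecMul]
      rfl

variable {X' Y' : Matrix (Fin d) (Fin d) F} {W' : Matrix (Fin (n - 1)) (Fin n) F}

/-- A vector in the span of the first `k` rows is `(0, c, c X)`, with `c` padded by zeros to length
`d`. A common vector has the same `c` for both matrices, so `c (X - X') = 0`. -/
theorem inf_eq_bot (hW : IsBlock k a X Y W) (hW' : IsBlock k a X' Y' W')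
    (hX : IsUnit (X - X')) : rowSpaceFirst W k ⊓ rowSpaceFirst W' k = ⊥ := by
  have hs := hW.sum_eq
  have hle := hW.le
  rw [eq_bot_iff]
  rintro v ⟨hv, hv'⟩
  obtain ⟨c, h1, h2, h3, -⟩ := hW.exists_coeff (by omega) hv
  obtain ⟨c', h1', h2', h3', -⟩ := hW'.exists_coeff (by omega) hv'
  have hc : c = c' := by
    ext x
    by_cases hx : (x : ℕ) < k
    · rw [← h2 x ⟨a + x, by omega⟩ hx rfl, ← h2' x ⟨a + x, by omega⟩ hx rfl]
    · rw [h1 x (by omega), h1' x (by omega)]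
  subst hc
  have hzero : Matrix.vecMul c (X - X') = Matrix.vecMul 0 (X - X') := by
    rw [Matrix.vecMul_sub, Matrix.zero_vecMul, sub_eq_zero]
    ext j
    have e := h3 j ⟨a + k + j, by omega⟩ rfl
    rw [h3' j ⟨a + k + j, by omega⟩ rfl, vecMul_mixRows_of_support h1,
      vecMul_mixRows_of_support h1'] at e
    exact e.symm
  have hc0 : c = 0 := Matrix.vecMul_injective_iff_isUnit.mpr hX hzero
  refine hW.eq_zero_of_mem hv fun y hy hy' => ?_
  rw [h2 ⟨y - a, by omega⟩ y (by simp only; omega) (by simp only; omega), hc0, Pi.zero_apply]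

/-- The subspaces spanned by the first `t` rows of two matrices with the same shape differ. -/
theorem rowSpaceFirst_ne_of_isUnit (hW : IsBlock k a X X W) (hW' : IsBlock k a X' Y' W')
    (hY' : IsBlockPair X' Y') (hX : IsUnit (X - X')) {t : ℕ} (ht : 0 < t) (htd : t ≤ d + a) :
    rowSpaceFirst W t ≠ rowSpaceFirst W' t := by
  classical
  intro heq
  have hs := hW.sum_eq
  have hle := hW.le
  have hpos := hW.pos
  -- If the row spaces agreed, all rows of `X - X'` with index below `t` would lie in `L`. They are
  -- independent, but `L` is spanned by fewer vectors, since the indices below `k` are missing.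
  let L : Submodule F (Fin d → F) :=
    Submodule.span F (Set.range fun y : {y : Fin d // k ≤ (y : ℕ) ∧ (y : ℕ) < t} => Y' y)
  have hY'L : ∀ y : Fin d, k ≤ (y : ℕ) → (y : ℕ) < t → Y' y ∈ L := fun y h1 h2 =>
    Submodule.subset_span ⟨⟨y, h1, h2⟩, rfl⟩
  have hmem : ∀ x : Fin d, (x : ℕ) < t → (X - X') x ∈ L := by
    intro x hx
    have hxn : (x : ℕ) < n - 1 := by omega
    have hrow : W ⟨x, hxn⟩ ∈ rowSpaceFirst W' t := by
      rw [← heq]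
      exact row_mem_rowSpaceFirst W hx
    obtain ⟨c, h1, h2, h3, -⟩ := hW'.exists_coeff htd hrow
    have hX'L : k ≤ (x : ℕ) → X' x ∈ L := by
      intro hkx
      rcases hY' with ⟨-, rfl⟩ | ⟨rfl, -⟩
      · exact hY'L x hkx hx
      · exact L.zero_mem
    have hc : ∀ y : Fin d, (y : ℕ) < k → c y = if y = x then 1 else 0 := by
      intro y hy
      rw [← h2 y ⟨a + y, by omega⟩ hy rfl, hW.left _ _ x.isLt (by simp only; omega)]
      simp only [Fin.ext_iff]
      exact if_congr (by omega) rfl rfl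
    have hXx : X x = ∑ y, c y • mixRows k X' Y' y := by
      ext j
      have e := h3 j ⟨a + k + j, by omega⟩ rfl
      rw [hW.right _ _ x j rfl rfl, mixRows_self] at e
      rw [e, Finset.sum_apply]
      rfl
    have hrest : ∑ y : Fin d, (if (y : ℕ) < k then 0 else c y • Y' y) ∈ L := by
      refine L.sum_mem fun y _ => ?_
      split_ifs with hyk
      · exact L.zero_mem
      · by_cases hyt : (y : ℕ) < t
        · exact L.smul_mem _ (hY'L y (by omega) hyt)
        · rw [h1 y (by omega), zero_smul]
          exact L.zero_mem
    have hsum : X x = (if (x : ℕ) < k then X' x else 0)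
        + ∑ y : Fin d, (if (y : ℕ) < k then 0 else c y • Y' y) := by
      have : (if (x : ℕ) < k then X' x else 0)
          = ∑ y : Fin d, (if y = x then (if (x : ℕ) < k then X' x else 0) else 0) := by
        rw [Finset.sum_ite_eq' Finset.univ x]
        simp
      rw [this, ← Finset.sum_add_distrib, hXx]
      refine Finset.sum_congr rfl fun y _ => ?_
      by_cases hyk : (y : ℕ) < k
      · have e : mixRows k X' Y' y = X' y := by
          ext j
          simp [mixRows, hyk]
        rw [hc y hyk, e]
        by_cases hyx : y = x
        · subst hyx
          simp [hyk]
        · simp [hyx, hyk]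
      · have e : mixRows k X' Y' y = Y' y := by
          ext j
          simp [mixRows, hyk]
        rw [e]
        by_cases hyx : y = x
        · subst hyx
          simp [hyk]
        · simp [hyx, hyk]
    have hsub : (X - X') x = X x - X' x := rfl
    rw [hsub, hsum]
    split_ifs with hxk
    · rwa [add_sub_cancel_left]
    · rw [zero_add]
      exact L.sub_mem hrest (hX'L (by omega))
  have hli : LinearIndependent F (X - X') :=
    Matrix.vecMul_injective_iff.mp (Matrix.vecMul_injective_iff_isUnit.mpr hX)
  have hliL : LinearIndependent F
      (fun x : {x : Fin d // (x : ℕ) < t} => (⟨(X - X') x, hmem x x.2⟩ : L)) := by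
    have h1 := hli.comp (fun x : {x : Fin d // (x : ℕ) < t} => (x : Fin d))
      Subtype.val_injective
    exact LinearIndependent.of_comp L.subtype h1
  have hc1 := hliL.fintype_card_le_finrank
  have hc2 := finrank_range_le_card (R := F)
    (fun y : {y : Fin d // k ≤ (y : ℕ) ∧ (y : ℕ) < t} => Y' y)
  rw [Fintype.card_subtype] at hc1 hc2
  have hlt : (Finset.univ.filter fun y : Fin d => k ≤ (y : ℕ) ∧ (y : ℕ) < t).card
      < (Finset.univ.filter fun y : Fin d => (y : ℕ) < t).card := by
    refine Finset.card_lt_card ⟨fun y hy => ?_, fun h => ?_⟩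
    · simp only [Finset.mem_filter] at hy ⊢
      exact ⟨hy.1, hy.2.2⟩
    · have h0 : (⟨0, by omega⟩ : Fin d)
          ∈ Finset.univ.filter fun y : Fin d => (y : ℕ) < t := by simpa using ht
      have := h h0
      simp only [Finset.mem_filter] at this
      omega
  exact absurd (hc1.trans hc2) (by omega)

theorem rowSpaceFirst_ne (hW : IsBlock k a X Y W) (hW' : IsBlock k a X' Y' W')
    (hY : IsBlockPair X Y) (hY' : IsBlockPair X' Y') (hX : IsUnit (X - X')) {t : ℕ} (ht : 0 < t)
    (htd : t ≤ d + a) : rowSpaceFirst W t ≠ rowSpaceFirst W' t := by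
  rcases hY with ⟨h, rfl⟩ | ⟨rfl, rfl⟩
  · exact hW.rowSpaceFirst_ne_of_isUnit hW' hY' hX ht htd
  · rcases hY' with ⟨h', rfl⟩ | ⟨rfl, rfl⟩
    · refine (hW'.rowSpaceFirst_ne_of_isUnit hW (Or.inr ⟨rfl, rfl⟩) ?_ ht htd).symm
      rw [← neg_sub]
      exact hX.neg
    · have := hW.pos
      have := hW.le
      have : Nonempty (Fin d) := ⟨⟨0, by omega⟩⟩
      rw [sub_self] at hX
      exact absurd hX not_isUnit_zero

/-- Vectors orthogonal to the first `d + a` rows. -/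
theorem orthogonal (hW : IsBlock k a X Y W) (hY : IsBlockPair X Y) {v : Fin n → F}
    (hv : ∀ x : Fin (n - 1), (x : ℕ) < d + a → W x ⬝ᵥ v = 0) :
    (∀ y : Fin n, (y : ℕ) < a → v y = 0) ∧
      (∀ (i : Fin d) (y : Fin n), (i : ℕ) < k → (y : ℕ) = a + i →
        v y + Matrix.mulVec X (tail d v) i = 0) ∧
      (∀ i : Fin d, k ≤ (i : ℕ) → Matrix.mulVec X (tail d v) i = 0) ∧
      (∀ i : Fin d, k ≤ (i : ℕ) → Matrix.mulVec Y (tail d v) i = 0) := by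
  have hs := hW.sum_eq
  have hle := hW.le
  have hpos := hW.pos
  have h4 : ∀ i : Fin d, k ≤ (i : ℕ) → Matrix.mulVec Y (tail d v) i = 0 := fun i hi => by
    rw [← hW.row_dotProduct_of_le v ⟨i, by omega⟩ i (Or.inl ⟨rfl, hi⟩)]
    exact hv _ (by simp only; omega)
  refine ⟨fun y hy => ?_, fun i y hi hy => ?_, fun i hi => ?_, h4⟩
  · rw [← hW.row_dotProduct_lower v ⟨d + y, by omega⟩ y hy rfl]
    exact hv _ (by simp only; omega)
  · rw [← hW.row_dotProduct_of_lt v ⟨i, by omega⟩ i rfl y hi hy]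
    exact hv _ (by simp only; omega)
  · rcases hY with ⟨-, rfl⟩ | ⟨rfl, rfl⟩
    · exact h4 i hi
    · rw [Matrix.zero_mulVec, Pi.zero_apply]

theorem eq_zero_of_orthogonal (hW : IsBlock k a X Y W) (hY : IsBlockPair X Y) {v : Fin n → F}
    (hv : ∀ x : Fin (n - 1), (x : ℕ) < d + a → W x ⬝ᵥ v = 0)
    (h0 : ∀ y : Fin n, a + k ≤ (y : ℕ) → v y = 0) : v = 0 := by
  have hs := hW.sum_eq
  have hle := hW.le
  obtain ⟨h1, h2, -, -⟩ := hW.orthogonal hY hv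
  have htail : tail d v = 0 := by
    ext j
    rw [hW.tail_apply, h0 _ (by simp only; omega), Pi.zero_apply]
  ext y
  by_cases hya : (y : ℕ) < a
  · exact h1 y hya
  · by_cases hyk : (y : ℕ) < a + k
    · have := h2 ⟨y - a, by omega⟩ y (by simp only; omega) (by simp only; omega)
      rw [htail, Matrix.mulVec_zero, Pi.zero_apply, add_zero] at this
      rw [this, Pi.zero_apply]
    · exact h0 y (by omega)

theorem eq_zero_of_orthogonal_of_tail (hW : IsBlock k a X Y W) (hY : IsBlockPair X Y)
    {v : Fin n → F} (hv : ∀ x : Fin (n - 1), (x : ℕ) < d + a → W x ⬝ᵥ v = 0)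
    (h0 : tail d v = 0) : v = 0 := by
  have hs := hW.sum_eq
  refine hW.eq_zero_of_orthogonal hY hv fun y hy => ?_
  have := congrFun h0 ⟨y - (a + k), by omega⟩
  rw [hW.tail_apply, Pi.zero_apply] at this
  rw [← this]
  congr 1
  ext
  simp only
  omega

/-- Orthogonality determines `X` times the tail of `v`: its first `k` entries are the negated middle
block of `v`, the others vanish. The same holds for `X'`, so `X - X'` kills the tail. -/
theorem orthogonal_eq_zero (hW : IsBlock k a X Y W) (hW' : IsBlock k a X' Y' W')
    (hY : IsBlockPair X Y) (hY' : IsBlockPair X' Y') (hX : IsUnit (X - X')) {v : Fin n → F}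
    (hv : ∀ x : Fin (n - 1), (x : ℕ) < d + a → W x ⬝ᵥ v = 0)
    (hv' : ∀ x : Fin (n - 1), (x : ℕ) < d + a → W' x ⬝ᵥ v = 0) : v = 0 := by
  have hs := hW.sum_eq
  have hle := hW.le
  obtain ⟨-, h2, h3, -⟩ := hW.orthogonal hY hv
  obtain ⟨-, h2', h3', -⟩ := hW'.orthogonal hY' hv'
  refine hW.eq_zero_of_orthogonal_of_tail hY hv ?_
  refine Matrix.mulVec_injective_iff_isUnit.mpr hX ?_
  rw [Matrix.mulVec_zero, Matrix.sub_mulVec, sub_eq_zero]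
  ext i
  by_cases hi : (i : ℕ) < k
  · have e := h2 i ⟨a + i, by omega⟩ hi rfl
    have e' := h2' i ⟨a + i, by omega⟩ hi rfl
    exact add_left_cancel (e.trans e'.symm)
  · rw [h3 i (by omega), h3' i (by omega)]

end IsBlock

end Blocks

/-! ### Comparison of different block shapes and of the reversed matrix -/

section DifferentBlocks

variable {F : Type*} [Field F]

namespace IsBlock

variable {k a n d a' d' : ℕ} {X Y : Matrix (Fin d) (Fin d) F} {X' Y' : Matrix (Fin d') (Fin d') F}
  {W W' : Matrix (Fin (n - 1)) (Fin n) F}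

/-- The first `k` rows of `W` vanish on the first `a` columns, which contain the identity block of
`W'`. -/
theorem inf_eq_bot_of_lt (hW : IsBlock k a X Y W) (hW' : IsBlock k a' X' Y' W')
    (haa : a' + k ≤ a) : rowSpaceFirst W k ⊓ rowSpaceFirst W' k = ⊥ := by
  have hle := hW.le
  rw [eq_bot_iff]
  rintro v ⟨hv, hv'⟩
  obtain ⟨c, -, -, -, h4⟩ := hW.exists_coeff (by omega) hv
  exact hW'.eq_zero_of_mem hv' fun y _ hy => h4 hle y (by omega)

/-- The unit rows of `W` force `v` to vanish on the first `a` columns, hence on the middle block of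
`W'`. If `X'` is invertible, the tail for `W'` is then `0`; if `X' = 0`, the rows of `Y' = 1` kill
all columns from `a' + 2 k ≤ a + k` on. -/
theorem orthogonal_eq_zero_of_lt (hW : IsBlock k a X Y W) (hW' : IsBlock k a' X' Y' W')
    (hY : IsBlockPair X Y) (hY' : IsBlockPair X' Y') (haa : a' + k ≤ a) {v : Fin n → F}
    (hv : ∀ x : Fin (n - 1), (x : ℕ) < d + a → W x ⬝ᵥ v = 0)
    (hv' : ∀ x : Fin (n - 1), (x : ℕ) < d' + a' → W' x ⬝ᵥ v = 0) : v = 0 := by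
  have hs := hW.sum_eq
  have hs' := hW'.sum_eq
  have hle' := hW'.le
  obtain ⟨h1, -, -, -⟩ := hW.orthogonal hY hv
  obtain ⟨-, h2', h3', h4'⟩ := hW'.orthogonal hY' hv'
  rcases hY' with ⟨hX', rfl⟩ | ⟨rfl, rfl⟩
  · refine hW'.eq_zero_of_orthogonal_of_tail (Or.inl ⟨hX', rfl⟩) hv' ?_
    refine Matrix.mulVec_injective_iff_isUnit.mpr hX' ?_
    rw [Matrix.mulVec_zero]
    ext i
    by_cases hi : (i : ℕ) < k
    · have := h2' i ⟨a' + i, by omega⟩ hi rfl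
      rwa [h1 _ (by simp only; omega), zero_add] at this
    · exact h3' i (by omega)
  · refine hW.eq_zero_of_orthogonal hY hv fun y hy => ?_
    have := h4' ⟨y - (a' + k), by omega⟩ (by simp only; omega)
    rw [Matrix.one_mulVec, hW'.tail_apply] at this
    rw [← this]
    congr 1
    ext
    simp only
    omega

/-- If only the second matrix has a zero block in front of its first `t` rows. -/
theorem rowSpaceFirst_ne_of_le (hW : IsBlock k a X Y W) (hW' : IsBlock k a' X' Y' W') {t : ℕ}
    (ht : 0 < t) (htd : t ≤ d') (haa : a < a') : rowSpaceFirst W t ≠ rowSpaceFirst W' t := by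
  intro heq
  have hs := hW.sum_eq
  have hs' := hW'.sum_eq
  have hle := hW.le
  have hpos := hW.pos
  have hrow : W ⟨0, by omega⟩ ∈ rowSpaceFirst W' t := by
    rw [← heq]
    exact row_mem_rowSpaceFirst W ht
  obtain ⟨-, -, -, -, h4⟩ := hW'.exists_coeff (by omega) hrow
  have := h4 htd ⟨a, by omega⟩ haa
  rw [hW.left _ _ (by simp only; omega) (by simp only; omega), if_pos (by simp)] at this
  exact one_ne_zero this

/-- If only the second matrix has a zero block in front of its first `t` rows. -/
theorem rowSpaceFirst_ne_of_lower (hW : IsBlock k a X Y W) (hW' : IsBlock k a' X' Y' W') {t : ℕ}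
    (hdt : d < t) (ha : 0 < a) (htd : t ≤ d') (ha' : 0 < a') :
    rowSpaceFirst W t ≠ rowSpaceFirst W' t := by
  intro heq
  have hs := hW.sum_eq
  have hpos := hW.pos
  have hrow : W ⟨d, by omega⟩ ∈ rowSpaceFirst W' t := by
    rw [← heq]
    exact row_mem_rowSpaceFirst W hdt
  obtain ⟨-, -, -, -, h4⟩ := hW'.exists_coeff (by omega) hrow
  have := h4 htd ⟨0, by omega⟩ ha'
  rw [hW.lower _ _ le_rfl (by simp only; omega), if_pos (by simp)] at this
  exact one_ne_zero this

/-- Here `W'` has no leading zero columns, so the unit row `e_0` of `W`, available since `d < t`, is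
not excluded by its support alone. -/
theorem rowSpaceFirst_ne_of_eq_zero (hW : IsBlock k a X Y W) (hW' : IsBlock k 0 X' Y' W')
    (hY : IsBlockPair X Y) (hY' : IsBlockPair X' Y') {t : ℕ} (hdt : d < t) (ha : 0 < a)
    (htd : t ≤ d') (hkd : k < d) (hat : t ≤ a + k) (hta : a ≤ t) :
    rowSpaceFirst W t ≠ rowSpaceFirst W' t := by
  intro heq
  have hs := hW.sum_eq
  have hs' := hW'.sum_eq
  have hpos := hW.pos
  have hlow : ∀ y : Fin n, W ⟨d, by omega⟩ y = if (y : ℕ) = 0 then 1 else 0 := fun y => by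
    rw [hW.lower _ _ le_rfl (by simp only; omega)]
    exact if_congr (by simp) rfl rfl
  have hrow : W ⟨d, by omega⟩ ∈ rowSpaceFirst W' t := by
    rw [← heq]
    exact row_mem_rowSpaceFirst W hdt
  obtain ⟨c, h1, h2, h3, -⟩ := hW'.exists_coeff (by omega) hrow
  rcases hY' with ⟨hX', rfl⟩ | ⟨rfl, rfl⟩
  -- The row `e_0` vanishes on the tail of `W'`, so an invertible `X'` forces `c = 0`, although
  -- column `0` gives `c 0 = 1`.
  · have hc : c = 0 := by
      refine Matrix.vecMul_injective_iff_isUnit.mpr hX' ?_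
      ext j
      have := h3 j ⟨0 + k + j, by omega⟩ rfl
      rw [hlow, if_neg (by simp only; omega), mixRows_self] at this
      simp only [Matrix.zero_vecMul]
      exact this.symm
    have := h2 ⟨0, by omega⟩ ⟨0, by omega⟩ hpos rfl
    rw [hlow, if_pos rfl, hc] at this
    exact one_ne_zero this
  -- For `X' = 0`, `Y' = 1` the first `t` rows of `W'` end before column `k + t`.
  · have hzero : ∀ v ∈ rowSpaceFirst W t, ∀ y : Fin n, k + t ≤ (y : ℕ) → v y = 0 := by
      intro v hv y hy
      rw [heq] at hv
      obtain ⟨c, h1, -, h3, -⟩ := hW'.exists_coeff (by omega) hv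
      rw [h3 ⟨y - k, by omega⟩ y (by simp only; omega)]
      rw [Matrix.vecMul, dotProduct]
      refine Finset.sum_eq_zero fun x _ => ?_
      by_cases hx : t ≤ (x : ℕ)
      · rw [h1 x hx, zero_mul]
      · simp only [mixRows, Matrix.of_apply]
        split_ifs
        · rw [Matrix.zero_apply, mul_zero]
        · rw [Matrix.one_apply_ne, mul_zero]
          simp only [ne_eq, Fin.ext_iff]
          omega
    rcases hY with ⟨hX, rfl⟩ | ⟨rfl, rfl⟩
    -- Column `k + t` of `W` contains column `t - a` of `X`, which would be zero because all its `d
    -- < t` rows are involved.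
    · have hj : Matrix.mulVec Y (Pi.single ⟨t - a, by omega⟩ 1) = Matrix.mulVec Y 0 := by
        rw [Matrix.mulVec_zero, Matrix.mulVec_single_one]
        ext x
        have := hzero _ (row_mem_rowSpaceFirst W (x := ⟨x, by omega⟩) (by simp only; omega))
          ⟨a + k + (t - a), by omega⟩ (by simp only; omega)
        rw [hW.right _ _ x ⟨t - a, by omega⟩ rfl rfl, mixRows_self] at this
        exact this
      have := congrFun (Matrix.mulVec_injective_iff_isUnit.mpr hX hj) ⟨t - a, by omega⟩
      rw [Pi.single_eq_same] at this
      exact one_ne_zero this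
    · have := hzero _ (row_mem_rowSpaceFirst W (x := ⟨k, by omega⟩) (by simp only; omega))
        ⟨a + k + k, by omega⟩ (by simp only; omega)
      rw [hW.right _ _ ⟨k, hkd⟩ ⟨k, hkd⟩ rfl rfl, mixRows, Matrix.of_apply,
        if_neg (by simp), Matrix.one_apply_eq] at this
      exact one_ne_zero this

end IsBlock

/-- The rows of `W` are the last unit vectors in reverse order. -/
def IsReversed {n : ℕ} (W : Matrix (Fin (n - 1)) (Fin n) F) : Prop :=
  ∀ x y, W x y = if (x : ℕ) + y + 1 = n then 1 else 0

namespace IsReversed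

variable {k a n d : ℕ} {X Y : Matrix (Fin d) (Fin d) F} {W M : Matrix (Fin (n - 1)) (Fin n) F}

theorem apply_eq_zero (hM : IsReversed M) {t : ℕ} {v : Fin n → F} (hv : v ∈ rowSpaceFirst M t)
    {y : Fin n} (hy : (y : ℕ) + t < n) : v y = 0 := by
  induction hv using Submodule.span_induction with
  | mem v hv =>
    obtain ⟨x, hx, rfl⟩ := hv
    rw [hM, if_neg (by omega)]
  | zero => rfl
  | add v w _ _ hv hw => rw [Pi.add_apply, hv, hw, add_zero]
  | smul r v _ hv => rw [Pi.smul_apply, hv, smul_zero]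

theorem row_dotProduct (hM : IsReversed M) (v : Fin n → F) (x : Fin (n - 1)) (y : Fin n)
    (hxy : (x : ℕ) + y + 1 = n) : M x ⬝ᵥ v = v y := by
  rw [dotProduct, Finset.sum_eq_single y]
  · rw [hM, if_pos hxy, one_mul]
  · intro z _ hz
    rw [hM, if_neg, zero_mul]
    intro h
    exact hz (Fin.ext (by omega))
  · simp

theorem linearIndependent (hM : IsReversed M) : LinearIndependent F M := by
  refine Fintype.linearIndependent_iff.mpr fun g hg x => ?_
  have := congrFun hg ⟨n - 1 - x, by omega⟩
  rw [Finset.sum_apply, Finset.sum_eq_single x] at this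
  · rwa [Pi.smul_apply, hM, if_pos (by simp only; omega), smul_eq_mul, mul_one] at this
  · intro z _ hz
    rw [Pi.smul_apply, hM, if_neg, smul_zero]
    intro h
    simp only at h
    exact hz (Fin.ext (by omega))
  · simp

theorem inf_eq_bot (hM : IsReversed M) (hW : IsBlock k a X Y W) :
    rowSpaceFirst M k ⊓ rowSpaceFirst W k = ⊥ := by
  have hs := hW.sum_eq
  have hle := hW.le
  rw [eq_bot_iff]
  rintro v ⟨hv, hv'⟩
  exact hW.eq_zero_of_mem hv' fun y _ hy => hM.apply_eq_zero hv (by omega)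

theorem orthogonal_eq_zero (hM : IsReversed M) (hW : IsBlock k a X Y W) (hY : IsBlockPair X Y)
    {v : Fin n → F} (hv : ∀ x : Fin (n - 1), (x : ℕ) < d + a → M x ⬝ᵥ v = 0)
    (hv' : ∀ x : Fin (n - 1), (x : ℕ) < d + a → W x ⬝ᵥ v = 0) : v = 0 := by
  have hs := hW.sum_eq
  have hpos := hW.pos
  refine hW.eq_zero_of_orthogonal hY hv' fun y hy => ?_
  rw [← hM.row_dotProduct v ⟨n - 1 - y, by omega⟩ y (by simp only; omega)]
  exact hv _ (by simp only; omega)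

/-- The first `t` rows of `M` are supported on the last `t` columns. This excludes row `0` of `W`,
with entry `1` in column `a`, or else its unit row `e_0`. -/
theorem rowSpaceFirst_ne (hM : IsReversed M) (hW : IsBlock k a X Y W) {t : ℕ} (ht : 0 < t)
    (hat : a + t < n ∨ (0 < a ∧ d < t ∧ t < n)) : rowSpaceFirst M t ≠ rowSpaceFirst W t := by
  intro heq
  have hs := hW.sum_eq
  have hle := hW.le
  have hpos := hW.pos
  rcases hat with hat | ⟨ha, hdt, htn⟩
  · have hrow : W ⟨0, by omega⟩ ∈ rowSpaceFirst M t := by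
      rw [heq]
      exact row_mem_rowSpaceFirst W ht
    have := hM.apply_eq_zero hrow (y := ⟨a, by omega⟩) hat
    rw [hW.left _ _ (by simp only; omega) (by simp only; omega), if_pos (by simp)] at this
    exact one_ne_zero this
  · have hrow : W ⟨d, by omega⟩ ∈ rowSpaceFirst M t := by
      rw [heq]
      exact row_mem_rowSpaceFirst W hdt
    have := hM.apply_eq_zero hrow (y := ⟨0, by omega⟩) (by simp only; omega)
    rw [hW.lower _ _ le_rfl (by simp only; omega), if_pos (by simp)] at this
    exact one_ne_zero this

end IsReversed

/-- Equal row spaces of dimension `t < 2 k` contradict trivial intersection of those of dimension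
`k`. -/
theorem rowSpaceFirst_ne_of_inf_eq_bot {k m n t : ℕ} {W W' : Matrix (Fin m) (Fin n) F}
    (hW : LinearIndependent F W) (hW' : LinearIndependent F W') (ht : 0 < t) (htm : t ≤ m)
    (htk : t < 2 * k) (hinf : rowSpaceFirst W k ⊓ rowSpaceFirst W' k = ⊥) :
    rowSpaceFirst W t ≠ rowSpaceFirst W' t := by
  intro heq
  have hd := finrank_rowSpaceFirst hW htm
  by_cases h : t ≤ k
  · have h1 : rowSpaceFirst W t ≤ ⊥ := by
      rw [← hinf]
      exact le_inf (rowSpaceFirst_mono W h) (heq ▸ rowSpaceFirst_mono W' h)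
    rw [le_bot_iff.mp h1, finrank_bot] at hd
    omega
  · have h1 := Submodule.finrank_sup_add_finrank_inf_eq (rowSpaceFirst W k) (rowSpaceFirst W' k)
    rw [hinf, finrank_bot, finrank_rowSpaceFirst hW (by omega),
      finrank_rowSpaceFirst hW' (by omega)] at h1
    have h2 : rowSpaceFirst W k ⊔ rowSpaceFirst W' k ≤ rowSpaceFirst W t :=
      sup_le (rowSpaceFirst_mono W (by omega)) (heq ▸ rowSpaceFirst_mono W' (by omega))
    have h3 := Submodule.finrank_mono h2
    omega

/-- A common row space of dimension `t < n` contains the first `t'` rows of both matrices and still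
has a nonzero normal vector. -/
theorem rowSpaceFirst_ne_of_orthogonal {m n t t' : ℕ} {W W' : Matrix (Fin m) (Fin n) F}
    (hW : LinearIndependent F W) (htm : t ≤ m) (htn : t < n) (htt : t' ≤ t)
    (horth : ∀ v : Fin n → F, (∀ x : Fin m, (x : ℕ) < t' → W x ⬝ᵥ v = 0) →
      (∀ x : Fin m, (x : ℕ) < t' → W' x ⬝ᵥ v = 0) → v = 0) :
    rowSpaceFirst W t ≠ rowSpaceFirst W' t := by
  intro heq
  have hne : rowSpaceFirst W t ≠ ⊤ := by
    intro htop
    have := finrank_rowSpaceFirst hW htm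
    rw [htop, finrank_top, Module.finrank_fin_fun] at this
    omega
  obtain ⟨v, hv, h⟩ := exists_dotProduct_eq_zero hne
  refine hv (horth v (fun x hx => h _ (row_mem_rowSpaceFirst W (by omega))) fun x hx => h _ ?_)
  rw [heq]
  exact row_mem_rowSpaceFirst W' (by omega)

end DifferentBlocks

/-! ### The generator matrices and their pairwise comparison -/

section Generators

variable {F : Type*} [Field F]

theorem mul_diagBlock_of_lt {ι : Type*} {n m d : ℕ} (A : Matrix ι (Fin n) F)
    (X : Matrix (Fin d) (Fin d) F) (x : ι) {y : Fin n} (hy : (y : ℕ) < m) :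
    (A * diagBlock n m X) x y = A x y := by
  rw [Matrix.mul_apply, Finset.sum_eq_single y]
  · simp only [diagBlock, Matrix.of_apply]
    rw [dif_neg (by omega), if_pos trivial, mul_one]
  · intro z _ hz
    simp only [diagBlock, Matrix.of_apply]
    rw [dif_neg (by omega), if_neg hz, mul_zero]
  · simp

theorem mul_diagBlock_of_eq {ι : Type*} {n m d : ℕ} (hmd : m + d = n) (A : Matrix ι (Fin n) F)
    (X : Matrix (Fin d) (Fin d) F) (x : ι) {y : Fin n} {j : Fin d} (hy : (y : ℕ) = m + j) :
    (A * diagBlock n m X) x y = ∑ i : Fin d, A x ⟨m + i, by omega⟩ * X i j := by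
  rw [Matrix.mul_apply, sum_fin_split (show 0 + m + d = n by omega)]
  have e1 : ∑ z : Fin m, A x ⟨0 + z, by omega⟩ * diagBlock n m X ⟨0 + z, by omega⟩ y = 0 :=
    Finset.sum_eq_zero fun z _ => by
      simp only [diagBlock, Matrix.of_apply]
      rw [dif_neg (by omega), if_neg (by simp only [Fin.ext_iff]; omega), mul_zero]
  rw [Finset.univ_eq_empty, Finset.sum_empty, zero_add, e1, zero_add]
  refine Finset.sum_congr rfl fun z _ => ?_
  have e2 : (⟨0 + m + z, by omega⟩ : Fin n) = ⟨m + z, by omega⟩ := by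
    simp only [Fin.ext_iff]; omega
  rw [e2]
  congr 1
  simp only [diagBlock, Matrix.of_apply]
  rw [dif_pos (by omega)]
  congr 1
  · simp only [Fin.ext_iff]; omega
  · simp only [Fin.ext_iff]; omega

theorem sum_ite_mul_apply {d : ℕ} (X : Matrix (Fin d) (Fin d) F) {g : Fin d → F} (i j : Fin d)
    (hg : ∀ z, g z = if z = i then 1 else 0) : ∑ z, g z * X z j = X i j := by
  simp [hg]

/-- Multiplication by `diag(I, X)` affects only the last `d` columns, where each row of `A_i` is
zero or a unit vector and thus selects a row of `X`. -/
theorem isBlock_matA {s k h i : ℕ} (hk : 0 < k) (hle : k ≤ i * k + h)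
    (hsum : (s - i - 1) * k + k + (i * k + h) = s * k + h)
    (X : Matrix (Fin (i * k + h)) (Fin (i * k + h)) F) :
    IsBlock k ((s - i - 1) * k) X X
      (matA F s k h i * diagBlock (s * k + h) ((s - i - 1) * k + k) X) := by
  have key : ∀ x y, matA F s k h i x y =
    if (x : ℕ) < k then
      (if (y : ℕ) = (s - i - 1) * k + x ∨ (y : ℕ) = (s - i - 1) * k + k + x then 1 else 0)
    else if (x : ℕ) < i * k + h then (if (y : ℕ) = (s - i - 1) * k + k + x then 1 else 0)
    else if (x : ℕ) < i * k + h + (s - i - 1) * k then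
      (if i * k + h + (y : ℕ) = x then 1 else 0)
    else (if i * k + h + (s - i - 1) * k + (y : ℕ) = (s - i - 1) * k + k + x then 1 else 0) :=
    fun _ _ => rfl
  generalize matA F s k h i = A at key
  -- Replacing the products by variables leaves linear arithmetic.
  generalize (s - i - 1) * k = a at *
  generalize i * k + h = d at *
  generalize s * k + h = n at *
  refine ⟨hsum, hk, hle, ?_, ?_, ?_, ?_, ?_⟩
  · intro x y hx hy
    rw [mul_diagBlock_of_lt _ _ _ hy, key]
    split_ifs <;> first | rfl | omega
  · intro x y z j hx hy
    rw [mul_diagBlock_of_eq hsum _ _ _ hy, mixRows_self]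
    refine sum_ite_mul_apply X z j fun w => ?_
    rw [key]
    simp only [Fin.ext_iff]
    split_ifs <;> first | rfl | omega
  · intro x y hx hx'
    by_cases hy : (y : ℕ) < a + k
    · rw [mul_diagBlock_of_lt _ _ _ hy, key]
      split_ifs <;> first | rfl | omega
    · rw [mul_diagBlock_of_eq hsum _ _ _ (j := ⟨y - (a + k), by omega⟩) (by simp only; omega),
        if_neg (by omega)]
      refine Finset.sum_eq_zero fun z _ => ?_
      rw [key, if_neg (by omega), if_neg (by omega), if_pos hx', if_neg (by simp only; omega),
        zero_mul]
  · intro x y hx hy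
    rw [mul_diagBlock_of_lt _ _ _ hy, key]
    split_ifs <;> first | rfl | omega
  · intro x y z j hx hy
    rw [mul_diagBlock_of_eq hsum _ _ _ hy]
    refine sum_ite_mul_apply X z j fun w => ?_
    rw [key]
    simp only [Fin.ext_iff]
    split_ifs <;> first | rfl | omega

theorem isBlock_matB {s k h i : ℕ} (hk : 0 < k) (hle : k ≤ i * k + h)
    (hsum : (s - i - 1) * k + k + (i * k + h) = s * k + h) :
    IsBlock k ((s - i - 1) * k) (0 : Matrix (Fin (i * k + h)) (Fin (i * k + h)) F) 1
      (matB F s k h i) := by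
  have key : ∀ x y, matB F s k h i x y =
    if (x : ℕ) < k then (if (y : ℕ) = (s - i - 1) * k + x then 1 else 0)
    else if (x : ℕ) < i * k + h then (if (y : ℕ) = (s - i - 1) * k + k + x then 1 else 0)
    else if (x : ℕ) < i * k + h + (s - i - 1) * k then
      (if i * k + h + (y : ℕ) = x then 1 else 0)
    else (if i * k + h + (s - i - 1) * k + (y : ℕ) = (s - i - 1) * k + k + x then 1 else 0) :=
    fun _ _ => rfl
  generalize matB F s k h i = B at key
  generalize (s - i - 1) * k = a at *
  generalize i * k + h = d at *
  generalize s * k + h = n at *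
  refine ⟨hsum, hk, hle, ?_, ?_, ?_, ?_, ?_⟩
  · intro x y hx hy
    rw [key]
    split_ifs <;> first | rfl | omega
  · intro x y z j hx hy
    rw [key, mixRows, Matrix.of_apply, Matrix.zero_apply, Matrix.one_apply]
    simp only [Fin.ext_iff]
    split_ifs <;> first | rfl | omega
  · intro x y hx hx'
    rw [key]
    split_ifs <;> first | rfl | omega
  · intro x y hx hy
    rw [key]
    split_ifs <;> first | rfl | omega
  · intro x y z j hx hy
    rw [key, Matrix.one_apply]
    simp only [Fin.ext_iff]
    split_ifs <;> first | rfl | omega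

theorem isReversed_matM (s k h : ℕ) : IsReversed (matM F s k h) := fun _ _ => rfl

/-- The indices of the generator matrices: `none` for `M`, and `(i, X)` for `A_i g`, where `X` is
the lower right block of `g`, or for `B_i`, if `X = 0`. -/
abbrev GeneratorIndex (s k h : ℕ) (f : ℕ → F[X]) : Type _ :=
  Option (Σ i : Finset.Icc 1 (s - 1), companionField ((i : ℕ) * k + h) (f i))

open Classical in
/-- The generator matrix with a given index. -/
noncomputable def generator (s k h : ℕ) (f : ℕ → F[X]) :
    GeneratorIndex s k h f → Matrix (Fin (s * k + h - 1)) (Fin (s * k + h)) F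
  | none => matM F s k h
  | some ⟨i, X⟩ =>
    if (X : Matrix (Fin ((i : ℕ) * k + h)) (Fin ((i : ℕ) * k + h)) F) = 0 then matB F s k h i
    else matA F s k h i * diagBlock (s * k + h) ((s - i - 1) * k + k)
      (X : Matrix (Fin ((i : ℕ) * k + h)) (Fin ((i : ℕ) * k + h)) F)

variable [Fintype F] {s k h : ℕ} {f : ℕ → F[X]}

theorem range_generator (hk : 0 < k)
    (hf : ∀ i ∈ Finset.Icc 1 (s - 1), IsPrimitivePoly (i * k + h) (f i)) :
    Set.range (generator s k h f) = generatorMatrices s k h f := by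
  have hpos : ∀ i ∈ Finset.Icc 1 (s - 1), 0 < i * k + h := fun i hi => by
    have := Nat.mul_pos (show 0 < i from (Finset.mem_Icc.mp hi).1) hk
    omega
  ext W
  constructor
  · rintro ⟨_ | ⟨i, X⟩, rfl⟩
    · exact Or.inr (Or.inr rfl)
    · simp only [generator]
      split_ifs with hX
      · exact Or.inr (Or.inl ⟨i, i.2, rfl⟩)
      · exact Or.inl ⟨i, i.2, _, ⟨X, X.2.resolve_left hX, rfl⟩, rfl⟩
  · rintro (⟨i, hi, g, ⟨X, hX, rfl⟩, rfl⟩ | ⟨i, hi, rfl⟩ | rfl)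
    · refine ⟨some ⟨⟨i, hi⟩, ⟨X, Or.inr hX⟩⟩, ?_⟩
      have : Nonempty (Fin (i * k + h)) := ⟨⟨0, hpos i hi⟩⟩
      exact if_neg ((companionField_spec (hf i hi) (hpos i hi)).2.1 X hX).ne_zero
    · exact ⟨some ⟨⟨i, hi⟩, ⟨0, Or.inl rfl⟩⟩, if_pos rfl⟩
    · exact ⟨none, rfl⟩

theorem block_widths_sum {i : ℕ} (hi : i ∈ Finset.Icc 1 (s - 1)) :
    (s - i - 1) * k + k + (i * k + h) = s * k + h := by
  rw [Finset.mem_Icc] at hi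
  obtain ⟨e, rfl⟩ : ∃ e, s = i + 1 + e := ⟨s - (i + 1), by omega⟩
  rw [show i + 1 + e - i - 1 = e by omega]
  ring

theorem exists_isBlock_generator (hk : 0 < k)
    (hf : ∀ i ∈ Finset.Icc 1 (s - 1), IsPrimitivePoly (i * k + h) (f i))
    (i : Finset.Icc 1 (s - 1)) (X : companionField ((i : ℕ) * k + h) (f i)) :
    ∃ Y, IsBlockPair (X : Matrix (Fin ((i : ℕ) * k + h)) (Fin ((i : ℕ) * k + h)) F) Y ∧
      IsBlock k ((s - i - 1) * k) X Y (generator s k h f (some ⟨i, X⟩)) := by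
  have hi := Finset.mem_Icc.mp i.2
  have hle : k ≤ i * k + h := by
    have := Nat.mul_le_mul_right k hi.1
    omega
  by_cases hX : (X : Matrix (Fin ((i : ℕ) * k + h)) (Fin ((i : ℕ) * k + h)) F) = 0
  · refine ⟨1, Or.inr ⟨hX, rfl⟩, ?_⟩
    simp only [generator]
    rw [if_pos hX, hX]
    exact isBlock_matB hk hle (block_widths_sum i.2)
  · refine ⟨X, Or.inl ⟨?_, rfl⟩, ?_⟩
    · exact (companionField_spec (hf i i.2) (by omega)).2.1 X (X.2.resolve_left hX)
    · simp only [generator]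
      rw [if_neg hX]
      exact isBlock_matA hk hle (block_widths_sum i.2) X.1

theorem linearIndependent_generator (hk : 0 < k)
    (hf : ∀ i ∈ Finset.Icc 1 (s - 1), IsPrimitivePoly (i * k + h) (f i))
    (p : GeneratorIndex s k h f) : LinearIndependent F (generator s k h f p) := by
  rcases p with _ | ⟨i, X⟩
  · exact (isReversed_matM s k h).linearIndependent
  · obtain ⟨Y, hY, hW⟩ := exists_isBlock_generator hk hf i X
    exact hW.linearIndependent hY.isUnit_right

/-- To check a symmetric relation for all pairs of generator matrices, it suffices to check it for
`M` and a block matrix, for block matrices with the same `i`, and for those with `i < i'`. -/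
theorem generator_pairwise (hk : 0 < k)
    (hf : ∀ i ∈ Finset.Icc 1 (s - 1), IsPrimitivePoly (i * k + h) (f i))
    {R : Matrix (Fin (s * k + h - 1)) (Fin (s * k + h)) F →
      Matrix (Fin (s * k + h - 1)) (Fin (s * k + h)) F → Prop}
    (hsymm : ∀ W W', R W W' → R W' W)
    (hM : ∀ M W, IsReversed M → ∀ i ∈ Finset.Icc 1 (s - 1),
      ∀ X Y : Matrix (Fin (i * k + h)) (Fin (i * k + h)) F, IsBlockPair X Y →
        IsBlock k ((s - i - 1) * k) X Y W → R M W)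
    (hsame : ∀ W W', ∀ i ∈ Finset.Icc 1 (s - 1),
      ∀ X Y X' Y' : Matrix (Fin (i * k + h)) (Fin (i * k + h)) F,
        IsBlockPair X Y → IsBlockPair X' Y' → IsUnit (X - X') →
        IsBlock k ((s - i - 1) * k) X Y W → IsBlock k ((s - i - 1) * k) X' Y' W' → R W W')
    (hlt : ∀ W W', ∀ i ∈ Finset.Icc 1 (s - 1), ∀ i' ∈ Finset.Icc 1 (s - 1), i < i' →
      ∀ (X Y : Matrix (Fin (i * k + h)) (Fin (i * k + h)) F)
        (X' Y' : Matrix (Fin (i' * k + h)) (Fin (i' * k + h)) F),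
        IsBlockPair X Y → IsBlockPair X' Y' →
        IsBlock k ((s - i - 1) * k) X Y W → IsBlock k ((s - i' - 1) * k) X' Y' W' → R W W')
    {p p' : GeneratorIndex s k h f} (hp : p ≠ p') :
    R (generator s k h f p) (generator s k h f p') := by
  have hrev := isReversed_matM (F := F) s k h
  rcases p with _ | ⟨i, X⟩
  · rcases p' with _ | ⟨i', X'⟩
    · exact absurd rfl hp
    · obtain ⟨Y', hY', hW'⟩ := exists_isBlock_generator hk hf i' X'
      exact hM _ _ hrev i' i'.2 _ _ hY' hW'
  · obtain ⟨Y, hY, hW⟩ := exists_isBlock_generator hk hf i X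
    rcases p' with _ | ⟨i', X'⟩
    · exact hsymm _ _ (hM _ _ hrev i i.2 _ _ hY hW)
    · obtain ⟨Y', hY', hW'⟩ := exists_isBlock_generator hk hf i' X'
      rcases lt_trichotomy (i : ℕ) i' with h1 | h1 | h1
      · exact hlt _ _ i i.2 i' i'.2 h1 _ _ _ _ hY hY' hW hW'
      · obtain rfl : i = i' := Subtype.ext h1
        have hne : X ≠ X' := by
          rintro rfl
          exact hp rfl
        have hpos := Nat.mul_pos (show 0 < (i : ℕ) from (Finset.mem_Icc.mp i.2).1) hk
        exact hsame _ _ i i.2 _ _ _ _ hY hY'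
          ((companionField_spec (hf i i.2) (by omega)).2.2 _ X.2 _ X'.2
            (fun h => hne (Subtype.ext h))) hW hW'
      · exact hsymm _ _ (hlt _ _ i' i'.2 i i.2 h1 _ _ _ _ hY' hY hW' hW)

theorem natCard_generatorIndex (hk : 0 < k)
    (hf : ∀ i ∈ Finset.Icc 1 (s - 1), IsPrimitivePoly (i * k + h) (f i)) :
    Nat.card (GeneratorIndex s k h f)
      = (∑ i ∈ Finset.Icc 1 (s - 1), Fintype.card F ^ (i * k + h)) + 1 := by
  rw [Finite.card_option, Nat.card_sigma]
  congr 1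
  rw [← Finset.sum_coe_sort (Finset.Icc 1 (s - 1)) fun i => Fintype.card F ^ (i * k + h)]
  refine Finset.sum_congr rfl fun i _ => ?_
  have hpos := Nat.mul_pos (show 0 < (i : ℕ) from (Finset.mem_Icc.mp i.2).1) hk
  rw [Nat.card_coe_set_eq]
  exact (companionField_spec (hf i i.2) (by omega)).1

/-- The row spaces of the first `k` rows of the generator matrices form a partial spread. -/
theorem generator_inf_eq_bot (hk : 0 < k)
    (hf : ∀ i ∈ Finset.Icc 1 (s - 1), IsPrimitivePoly (i * k + h) (f i))
    {p p' : GeneratorIndex s k h f} (hp : p ≠ p') :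
    rowSpaceFirst (generator s k h f p) k ⊓ rowSpaceFirst (generator s k h f p') k = ⊥ := by
  refine generator_pairwise hk hf (R := fun W W' => rowSpaceFirst W k ⊓ rowSpaceFirst W' k = ⊥)
    (fun W W' h => by rwa [inf_comm]) ?_ ?_ ?_ hp
  · intro M W hrev i hi X Y _ hW
    exact hrev.inf_eq_bot hW
  · intro W W' i hi X Y X' Y' _ _ hX hW hW'
    exact hW.inf_eq_bot hW' hX
  · intro W W' i hi i' hi' hii X Y X' Y' _ _ hW hW'
    refine hW.inf_eq_bot_of_lt hW' ?_
    rw [Finset.mem_Icc] at hi hi'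
    have := Nat.mul_le_mul_right k (show s - i' - 1 + 1 ≤ s - i - 1 by omega)
    rw [add_mul] at this
    omega

/-- The row spaces of the first `(s - 1) k + h` rows of the generator matrices form the dual of a
partial spread. -/
theorem generator_orthogonal (hk : 0 < k)
    (hf : ∀ i ∈ Finset.Icc 1 (s - 1), IsPrimitivePoly (i * k + h) (f i))
    {p p' : GeneratorIndex s k h f} (hp : p ≠ p') (v : Fin (s * k + h) → F)
    (hv : ∀ x : Fin (s * k + h - 1), (x : ℕ) < (s - 1) * k + h →
      generator s k h f p x ⬝ᵥ v = 0)
    (hv' : ∀ x : Fin (s * k + h - 1), (x : ℕ) < (s - 1) * k + h →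
      generator s k h f p' x ⬝ᵥ v = 0) : v = 0 := by
  have hda : ∀ i ∈ Finset.Icc 1 (s - 1), i * k + h + (s - i - 1) * k = (s - 1) * k + h := by
    intro i hi
    rw [Finset.mem_Icc] at hi
    rw [show s - 1 = i + (s - i - 1) by omega, add_mul]
    ring
  revert hv hv'
  refine generator_pairwise hk hf (R := fun W W' => (∀ x : Fin (s * k + h - 1),
    (x : ℕ) < (s - 1) * k + h → W x ⬝ᵥ v = 0) → (∀ x : Fin (s * k + h - 1),
    (x : ℕ) < (s - 1) * k + h → W' x ⬝ᵥ v = 0) → v = 0)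
    (fun W W' h h1 h2 => h h2 h1) ?_ ?_ ?_ hp
  · intro M W hrev i hi X Y hY hW hv hv'
    rw [← hda i hi] at hv hv'
    exact hrev.orthogonal_eq_zero hW hY hv hv'
  · intro W W' i hi X Y X' Y' hY hY' hX hW hW' hv hv'
    rw [← hda i hi] at hv hv'
    exact hW.orthogonal_eq_zero hW' hY hY' hX hv hv'
  · intro W W' i hi i' hi' hii X Y X' Y' hY hY' hW hW' hv hv'
    rw [← hda i hi] at hv
    rw [← hda i' hi'] at hv'
    refine hW.orthogonal_eq_zero_of_lt hW' hY hY' ?_ hv hv'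
    rw [Finset.mem_Icc] at hi hi'
    have := Nat.mul_le_mul_right k (show s - i' - 1 + 1 ≤ s - i - 1 by omega)
    rw [add_mul] at this
    omega

/-- The condition `0 < h` is essential: for `h = 0` the first `2 k` rows of `B_1` and of `B_3` both
span the unit vectors of columns `0, …, k - 1` and `2 k, …, 3 k - 1`. It enters for `i = 1`, `i' =
3`, as `k < d = k + h`. -/
theorem generator_four_rowSpaceFirst_ne (hhk : h < k) (hh : 0 < h)
    (hf : ∀ i ∈ Finset.Icc 1 3, IsPrimitivePoly (i * k + h) (f i))
    {p p' : GeneratorIndex 4 k h f} (hp : p ≠ p') :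
    rowSpaceFirst (generator 4 k h f p) (2 * k + h)
      ≠ rowSpaceFirst (generator 4 k h f p') (2 * k + h) := by
  refine generator_pairwise (s := 4) (by omega) hf
    (R := fun W W' => rowSpaceFirst W (2 * k + h) ≠ rowSpaceFirst W' (2 * k + h))
    (fun W W' h => h.symm) ?_ ?_ ?_ hp
  · intro M W hrev i hi X Y hY hW
    refine hrev.rowSpaceFirst_ne hW (by omega) ?_
    rw [Finset.mem_Icc] at hi
    obtain ⟨h1, h2⟩ := hi
    interval_cases i <;> omega
  · intro W W' i hi X Y X' Y' hY hY' hX hW hW'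
    refine hW.rowSpaceFirst_ne hW' hY hY' hX (by omega) ?_
    rw [Finset.mem_Icc] at hi
    obtain ⟨h1, h2⟩ := hi
    interval_cases i <;> omega
  · intro W W' i hi i' hi' hii X Y X' Y' hY hY' hW hW'
    rw [Finset.mem_Icc] at hi hi'
    have hcases : (i = 1 ∧ i' = 2) ∨ (i = 1 ∧ i' = 3) ∨ (i = 2 ∧ i' = 3) := by omega
    rcases hcases with ⟨rfl, rfl⟩ | ⟨rfl, rfl⟩ | ⟨rfl, rfl⟩
    · exact hW.rowSpaceFirst_ne_of_lower hW' (by omega) (by omega) (by omega) (by omega)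
    · rw [show (4 - 3 - 1) * k = 0 by omega] at hW'
      exact hW.rowSpaceFirst_ne_of_eq_zero hW' hY hY' (by omega) (by omega) (by omega) (by omega)
        (by omega) (by omega)
    · exact (hW'.rowSpaceFirst_ne_of_le hW (by omega) (by omega) (by omega)).symm

theorem generator_rowSpaceFirst_injective (hhk : h < k)
    (hf : ∀ i ∈ Finset.Icc 1 3, IsPrimitivePoly (i * k + h) (f i)) {t : ℕ}
    (ht : t ∈ Finset.Icc 1 (k + h) ∪ {2 * k + h} ∪ Finset.Icc (3 * k + h) (4 * k + h - 1))
    (hdeg : h = 0 → t ≠ 2 * k) :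
    Function.Injective fun p : GeneratorIndex 4 k h f =>
      rowSpaceFirst (generator 4 k h f p) t := by
  intro p p'
  contrapose!
  intro hp
  have hlin := linearIndependent_generator (s := 4) (show 0 < k by omega) hf
  simp only [Finset.mem_union, Finset.mem_Icc, Finset.mem_singleton] at ht
  rcases ht with (ht | ht) | ht
  · exact rowSpaceFirst_ne_of_inf_eq_bot (hlin p) (hlin p') (by omega) (by omega)
      (show t < 2 * k by omega) (generator_inf_eq_bot (s := 4) (by omega) hf hp)
  · subst ht
    exact generator_four_rowSpaceFirst_ne hhk
      (Nat.pos_of_ne_zero fun h0 => hdeg h0 (by omega)) hf hp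
  · exact rowSpaceFirst_ne_of_orthogonal (hlin p) (by omega) (by omega) (t' := (4 - 1) * k + h)
      (by omega) (generator_orthogonal (s := 4) (by omega) hf hp)

end Generators

/-! ### Optimality and the final theorem -/

/-- The bound for cardinality-consistent flag codes with a partial spread as projected code. -/
theorem ncard_flagCode_le {F : Type*} [Field F] [Fintype F] {k h r : ℕ}
    (hlarge : ((Fintype.card F : ℚ) ^ h - 1) / ((Fintype.card F : ℚ) - 1) < k)
    {C : Set (Fin r → Submodule F (Fin (4 * k + h) → F))} (hC : CardinalityConsistent C)
    {i : Fin r} (hi : IsPartialSpread k (projectedCode C i)) :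
    C.ncard ≤ (∑ i ∈ Finset.Icc 1 3, Fintype.card F ^ (i * k + h)) + 1 := by
  classical
  have hq : 1 < Fintype.card F := Fintype.one_lt_card
  have hfin : (projectedCode C i).Finite :=
    have : Finite (Submodule F (Fin (4 * k + h) → F)) :=
      Finite.of_injective (fun U => (U : Set (Fin (4 * k + h) → F))) SetLike.coe_injective
    Set.toFinite _
  rw [← hC i, Set.ncard_eq_toFinset_card _ hfin]
  refine card_partialSpread_le (k := k) (h := h) ?_ ?_ ?_ _ ?_ ?_
  · have hq1 : (Fintype.card F : ℚ) ≠ 1 := by exact_mod_cast hq.ne'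
    rw [← geom_sum_eq hq1] at hlarge
    exact_mod_cast hlarge
  · rw [Module.finrank_fin_fun, Finset.sum_Icc_succ_top (by omega),
      Finset.sum_Icc_succ_top (by omega), Finset.Icc_self, Finset.sum_singleton]
    -- With `q ^ k = 1 + e` the telescoping identity `m (q ^ k - 1) + q ^ (k + h) = q ^ (4 k + h)`
    -- is free of truncated subtraction.
    obtain ⟨e, he⟩ := Nat.exists_eq_add_of_le (Nat.one_le_pow k _ (by omega : 0 < Fintype.card F))
    have e1 : ∀ j, Fintype.card F ^ (j * k + h) = (1 + e) ^ j * Fintype.card F ^ h := fun j => by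
      rw [pow_add, mul_comm j, pow_mul, he]
    rw [e1, e1, e1, e1, pow_add _ k h, he, Nat.add_sub_cancel_left]
    ring
  · refine Finset.dvd_sum fun j hj => pow_dvd_pow _ ?_
    have := Nat.mul_le_mul_right k (Finset.mem_Icc.mp hj).1
    omega
  · intro U hU
    exact hi.2.1 U (hfin.mem_toFinset.mp hU)
  · intro U hU V hV hUV
    exact Submodule.finrank_eq_zero.mp
      (hi.2.2 U (hfin.mem_toFinset.mp hU) V (hfin.mem_toFinset.mp hV) hUV)

end FlagCodes

theorem corollary4p3 {F : Type*} [Field F] [Fintype F] (k h : ℕ) (hk : h < k)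
    -- primitive polynomials of degrees `i k + h`, `1 ≤ i ≤ 3`
    (f : ℕ → Polynomial F)
    (hf : ∀ i ∈ Finset.Icc 1 3, FlagCodes.IsPrimitivePoly (i * k + h) (f i))
    -- the type vector, with `k` among its entries
    {r : ℕ} (t : Fin r → ℕ) (ht : StrictMono t)
    (htypes : ∀ i, t i ∈ Finset.Icc 1 (k + h) ∪ {2 * k + h} ∪
      Finset.Icc (3 * k + h) (4 * k + h - 1))
    (i₀ : Fin r) (hi₀ : t i₀ = k)
    -- the degenerate dimension `2 k = n / 2` is excluded when `h = 0`
    (hdeg : h = 0 → ∀ i, t i ≠ 2 * k)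
    (hlarge : ((Fintype.card F : ℚ) ^ h - 1) / ((Fintype.card F : ℚ) - 1) < k) :
    FlagCodes.IsFlagCode t (FlagCodes.codeT 4 k h f t) ∧
    FlagCodes.CardinalityConsistent (FlagCodes.codeT 4 k h f t) ∧
    FlagCodes.IsPartialSpread k (FlagCodes.projectedCode (FlagCodes.codeT 4 k h f t) i₀) ∧
    (FlagCodes.codeT 4 k h f t).ncard =
      (∑ i ∈ Finset.Icc 1 3, Fintype.card F ^ (i * k + h)) + 1 ∧
    ∀ C : Set (Fin r → Submodule F (Fin (4 * k + h) → F)),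
      FlagCodes.IsFlagCode t C → FlagCodes.CardinalityConsistent C →
      FlagCodes.IsPartialSpread k (FlagCodes.projectedCode C i₀) →
      C.ncard ≤ (FlagCodes.codeT 4 k h f t).ncard := by
  have hk0 : 0 < k := by omega
  have hlin := FlagCodes.linearIndependent_generator (s := 4) hk0 hf
  have hinj := fun i => FlagCodes.generator_rowSpaceFirst_injective hk hf (htypes i)
    fun h0 => hdeg h0 i
  have hbounds : ∀ i, 1 ≤ t i ∧ t i ≤ 4 * k + h - 1 := fun i => by
    have := htypes i
    simp only [Finset.mem_union, Finset.mem_Icc, Finset.mem_singleton] at this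
    omega
  have hcode : FlagCodes.codeT 4 k h f t = Set.range
      fun (p : FlagCodes.GeneratorIndex 4 k h f) i =>
        FlagCodes.rowSpaceFirst (FlagCodes.generator 4 k h f p) (t i) := by
    rw [FlagCodes.codeT, ← FlagCodes.range_generator (s := 4) hk0 hf, ← Set.range_comp]
    rfl
  have hproj : ∀ i, FlagCodes.projectedCode (FlagCodes.codeT 4 k h f t) i = Set.range
      fun p : FlagCodes.GeneratorIndex 4 k h f =>
        FlagCodes.rowSpaceFirst (FlagCodes.generator 4 k h f p) (t i) := fun i => by
    rw [FlagCodes.projectedCode, hcode, ← Set.range_comp]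
    rfl
  have hrank : ∀ p i, Module.finrank F
      (FlagCodes.rowSpaceFirst (FlagCodes.generator 4 k h f p) (t i)) = t i :=
    fun p i => FlagCodes.finrank_rowSpaceFirst (hlin p) (hbounds i).2
  have hcard : (FlagCodes.codeT 4 k h f t).ncard =
      (∑ i ∈ Finset.Icc 1 3, Fintype.card F ^ (i * k + h)) + 1 := by
    -- Distinct components in dimension `k` already make the flags distinct.
    rw [hcode, ← Set.image_univ, Set.ncard_image_of_injective _
      (fun p p' hpp => hinj i₀ (congrFun hpp i₀)), Set.ncard_univ]
    exact FlagCodes.natCard_generatorIndex (s := 4) hk0 hf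
  refine ⟨⟨?_, ?_⟩, ?_, ⟨?_, ?_, ?_⟩, hcard, ?_⟩
  · rw [hcode]
    exact Set.range_nonempty _
  · rw [hcode]
    rintro _ ⟨p, rfl⟩
    refine ⟨fun i j hij => ?_, fun i => ⟨?_, ?_, hrank p i⟩⟩
    · refine lt_of_le_of_ne (FlagCodes.rowSpaceFirst_mono _ (ht hij).le) fun heq => ?_
      have := hrank p i
      simp only at heq
      rw [heq, hrank p j] at this
      exact (ht hij).ne' this
    · rw [bot_lt_iff_ne_bot]
      intro h0
      have := hrank p i
      simp only at h0
      rw [h0, finrank_bot] at this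
      have := (hbounds i).1
      omega
    · rw [lt_top_iff_ne_top]
      intro h0
      have := hrank p i
      simp only at h0
      rw [h0, finrank_top, Module.finrank_fin_fun] at this
      have := (hbounds i).2
      omega
  · intro i
    rw [hcard, hproj, ← Set.image_univ, Set.ncard_image_of_injective _ (hinj i), Set.ncard_univ]
    exact FlagCodes.natCard_generatorIndex (s := 4) hk0 hf
  · rw [hproj]
    exact Set.range_nonempty _
  · rw [hproj]
    rintro _ ⟨p, rfl⟩
    exact (hrank p i₀).trans hi₀
  · rw [hproj]
    rintro _ ⟨p, rfl⟩ _ ⟨p', rfl⟩ hne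
    have hb : ∀ j, j = k → FlagCodes.rowSpaceFirst (FlagCodes.generator 4 k h f p) j ⊓
        FlagCodes.rowSpaceFirst (FlagCodes.generator 4 k h f p') j = ⊥ := by
      rintro j rfl
      refine FlagCodes.generator_inf_eq_bot (s := 4) hk0 hf ?_
      rintro rfl
      exact hne rfl
    simp only
    rw [hb _ hi₀, finrank_bot]
  · intro C _ hC hspread
    rw [hcard]
    exact FlagCodes.ncard_flagCode_le hlarge hC hspread
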